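/- For a finite group $K$ let $A(K)$ be the Burnside ring of $K$, the Grothendieck group of the monoid of isomorphism classes of finite $K$-sets under disjoint union. Let $R(K)$ be the rational representation ring, the Grothendieck group of the monoid of isomorphism classes of finitely generated $\mathbb Q[K]$-modules under direct sum. Let $N(K)$ be the kernel of the map $A(K)\to R(K)$, $[X]\mapsto[\mathbb Q[X]]$. For finite groups $G,H$ put $\tilde G=G\times H$. Let $A(G,H)$ be the Grothendieck group of the monoid of isomorphism classes of finite $\tilde G$-sets on which $H$ acts freely; it is a subgroup of $A(\tilde G)$. Let $R(G,H)$ be the Grothendieck group of the monoid of isomorphism classes of finitely generated $\mathbb Q[\tilde G]$-modules that are free over $\mathbb Q[H]$, and let $N(G,H)$ be the kernel of the map $A(G,H)\to R(G,H)$, $[X]\mapsto[\mathbb Q[X]]$. A subquotient $L/C$ of $\tilde G$ is given by subgroups $C\trianglelefteq L\le\tilde G$. The induction map $L/C\uparrow\colon A(L/C)\to A(\tilde G)$ sends the class of an $L/C$-set $X$, regarded as an $L$-set, to $[\tilde G\times_L X]$. Let $\tilde A(L/C)\subseteq A(L/C)$ be the subgroup of those elements whose image under $L/C\uparrow$ lies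 in $A(G,H)$, and put $\tilde N(L/C)=N(L/C)\cap\tilde A(L/C)$. **Proposition.** Let $p$ be a prime, $G$ a finite elementary abelian $p$-group and $H\cong\mathbb Z_p$. Then $$N(G,H)=\sum L/C\uparrow\tilde N(L/C),$$ where the sum runs over all subquotients $L/C$ of $G\times H$ isomorphic to $\mathbb Z_p^3$. Moreover, the same equality holds when the sum is taken over all subquotients $L/C$ of $G\times H$ isomorphic to $T\times H$, where $T$ is $\mathbb Z_p\times\mathbb Z_p$, a nonabelian dihedral group, or a nonabelian group of order $p^3$ and exponent $p$. -/

import Mathlib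

universe u v

noncomputable section

namespace RelBurnside

/-! ### Finite `G`-sets and the Burnside group `A(G)` -/

/-- A finite `G`-set. -/
structure FinGSet (G : Type u) [Group G] : Type (u + 1) where
  carrier : Type u
  [action : MulAction G carrier]
  [finite : Finite carrier]

attribute [instance] FinGSet.action FinGSet.finite

/-- Isomorphism of finite `G`-sets: a `G`-equivariant bijection. -/
instance FinGSet.isoSetoid (G : Type u) [Group G] : Setoid (FinGSet G) where
  r X Y := ∃ e : X.carrier ≃ Y.carrier, ∀ (g : G) (x : X.carrier), e (g • x) = g • e x
  iseqv :=
    { refl := fun X => ⟨Equiv.refl _, fun _ _ => rfl⟩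
      symm := by
        rintro X Y ⟨e, he⟩
        refine ⟨e.symm, fun g y => ?_⟩
        rw [Equiv.symm_apply_eq, he, Equiv.apply_symm_apply]
      trans := by
        rintro X Y Z ⟨e, he⟩ ⟨f, hf⟩
        exact ⟨e.trans f, fun g x => by simp [he, hf]⟩ }

/-- The monoid of isomorphism classes of finite `G`-sets under disjoint union. -/
def GSetClass (G : Type u) [Group G] : Type (u + 1) := Quotient (FinGSet.isoSetoid G)

section GSetClass

variable {G : Type u} [Group G]

/-- The isomorphism class `[X]`. -/
def GSetClass.mk (X : FinGSet G) : GSetClass G := Quotient.mk _ X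

/-- The empty `G`-set. -/
def FinGSet.empty (G : Type u) [Group G] : FinGSet G :=
  letI : MulAction G PEmpty.{u + 1} :=
    { smul := fun _ x => x, one_smul := fun _ => rfl, mul_smul := fun _ _ _ => rfl }
  { carrier := PEmpty.{u + 1} }

/-- The disjoint union of two finite `G`-sets. -/
def FinGSet.sum (X Y : FinGSet G) : FinGSet G where
  carrier := X.carrier ⊕ Y.carrier

instance : Zero (GSetClass G) := ⟨GSetClass.mk (FinGSet.empty G)⟩

instance : Add (GSetClass G) :=
  ⟨Quotient.map₂ FinGSet.sum (by
    rintro X X' ⟨e, he⟩ Y Y' ⟨f, hf⟩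
    refine ⟨Equiv.sumCongr e f, ?_⟩
    rintro g (x | y)
    · exact congrArg Sum.inl (he g x)
    · exact congrArg Sum.inr (hf g y))⟩

theorem GSetClass.mk_add (X Y : FinGSet G) :
    GSetClass.mk X + GSetClass.mk Y = GSetClass.mk (X.sum Y) := rfl

instance : AddCommMonoid (GSetClass G) where
  add_assoc a b c := by
    induction a, b using Quotient.inductionOn₂ with | _ X Y =>
    induction c using Quotient.inductionOn with | _ Z =>
    refine Quotient.sound ⟨Equiv.sumAssoc _ _ _, ?_⟩
    rintro g ((x | y) | z) <;> rfl
  zero_add a := by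
    induction a using Quotient.inductionOn with | _ X =>
    refine Quotient.sound ⟨Equiv.emptySum PEmpty _, ?_⟩
    rintro g (x | y)
    · exact x.elim
    · rfl
  add_zero a := by
    induction a using Quotient.inductionOn with | _ X =>
    refine Quotient.sound ⟨Equiv.sumEmpty _ PEmpty, ?_⟩
    rintro g (x | y)
    · rfl
    · exact y.elim
  add_comm a b := by
    induction a, b using Quotient.inductionOn₂ with | _ X Y =>
    refine Quotient.sound ⟨Equiv.sumComm _ _, ?_⟩
    rintro g (x | y) <;> rfl
  nsmul := nsmulRec

end GSetClass

/-- The (additive group of the) Burnside ring `A(G)`. -/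
abbrev BurnsideGroup (G : Type u) [Group G] : Type (u + 1) :=
  Algebra.GrothendieckAddGroup (GSetClass G)

/-! ### Rational representations and the group `R(G)` -/

/-- A finite-dimensional rational representation of `G` (for finite `G`: a finitely generated
`ℚ[G]`-module). -/
structure FinRep (G : Type u) [Group G] : Type (u + 1) where
  carrier : Type u
  [addCommGroup : AddCommGroup carrier]
  [module : Module ℚ carrier]
  [finite : Module.Finite ℚ carrier]
  rep : Representation ℚ G carrier

attribute [instance] FinRep.addCommGroup FinRep.module FinRep.finite

/-- Isomorphism of representations. -/
instance FinRep.isoSetoid (G : Type u) [Group G] : Setoid (FinRep G) where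
  r V W := Nonempty (V.rep.Equiv W.rep)
  iseqv :=
    { refl := fun _ => ⟨Representation.Equiv.refl _⟩
      symm := fun ⟨e⟩ => ⟨e.symm⟩
      trans := fun ⟨e⟩ ⟨f⟩ => ⟨e.trans f⟩ }

/-- The monoid of isomorphism classes of finite-dimensional rational representations of `G`
under direct sum. -/
def RepClass (G : Type u) [Group G] : Type (u + 1) := Quotient (FinRep.isoSetoid G)

section RepClass

variable {G : Type u} [Group G]

/-- The isomorphism class `[V]`. -/
def RepClass.mk (V : FinRep G) : RepClass G := Quotient.mk _ V

/-- The zero representation. -/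
def FinRep.zero (G : Type u) [Group G] : FinRep G where
  carrier := PUnit.{u + 1}
  rep := 1

/-- The direct sum of two representations. -/
def FinRep.sum (V W : FinRep G) : FinRep G where
  carrier := V.carrier × W.carrier
  rep := V.rep.prod W.rep

instance : Zero (RepClass G) := ⟨RepClass.mk (FinRep.zero G)⟩

instance : Add (RepClass G) :=
  ⟨Quotient.map₂ FinRep.sum (by
    rintro V V' ⟨e⟩ W W' ⟨f⟩
    refine ⟨Representation.Equiv.mk (e.toLinearEquiv.prodCongr f.toLinearEquiv) fun g => ?_⟩
    refine LinearMap.ext fun x => Prod.ext ?_ ?_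
    · exact LinearMap.congr_fun (e.toIntertwiningMap.isIntertwining' g) x.1
    · exact LinearMap.congr_fun (f.toIntertwiningMap.isIntertwining' g) x.2)⟩

theorem RepClass.mk_add (V W : FinRep G) :
    RepClass.mk V + RepClass.mk W = RepClass.mk (V.sum W) := rfl

instance : AddCommMonoid (RepClass G) where
  add_assoc a b c := by
    induction a, b using Quotient.inductionOn₂ with | _ U V =>
    induction c using Quotient.inductionOn with | _ W =>
    exact Quotient.sound ⟨Representation.Equiv.mk (LinearEquiv.prodAssoc ℚ _ _ _) fun _ => rfl⟩
  zero_add a := by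
    induction a using Quotient.inductionOn with | _ V =>
    exact Quotient.sound ⟨Representation.Equiv.mk
      (LinearEquiv.uniqueProd : (PUnit.{u + 1} × V.carrier) ≃ₗ[ℚ] V.carrier) fun _ => rfl⟩
  add_zero a := by
    induction a using Quotient.inductionOn with | _ V =>
    exact Quotient.sound ⟨Representation.Equiv.mk
      (LinearEquiv.prodUnique : (V.carrier × PUnit.{u + 1}) ≃ₗ[ℚ] V.carrier) fun _ => rfl⟩
  add_comm a b := by
    induction a, b using Quotient.inductionOn₂ with | _ V W =>
    exact Quotient.sound ⟨Representation.Equiv.mk (LinearEquiv.prodComm ℚ _ _) fun _ => rfl⟩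
  nsmul := nsmulRec

end RepClass

/-- The (additive group of the) rational representation ring `R(G)`. -/
abbrev RepGroup (G : Type u) [Group G] : Type (u + 1) :=
  Algebra.GrothendieckAddGroup (RepClass G)

/-- Functoriality of the Grothendieck construction. -/
def grothMap {M N : Type*} [AddCommMonoid M] [AddCommMonoid N] (φ : M →+ N) :
    Algebra.GrothendieckAddGroup M →+ Algebra.GrothendieckAddGroup N :=
  Algebra.GrothendieckAddGroup.lift (Algebra.GrothendieckAddGroup.of.comp φ)

theorem grothMap_of {M N : Type*} [AddCommMonoid M] [AddCommMonoid N] (φ : M →+ N) (m : M) :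
    grothMap φ (Algebra.GrothendieckAddGroup.of m) = Algebra.GrothendieckAddGroup.of (φ m) :=
  DFunLike.congr_fun (Algebra.GrothendieckAddGroup.lift.symm_apply_apply
    (Algebra.GrothendieckAddGroup.of.comp φ)) m

theorem groth_hom_ext {M A : Type*} [AddCommMonoid M] [AddCommGroup A]
    {α β : Algebra.GrothendieckAddGroup M →+ A}
    (h : ∀ m, α (Algebra.GrothendieckAddGroup.of m) = β (Algebra.GrothendieckAddGroup.of m)) :
    α = β :=
  Algebra.GrothendieckAddGroup.lift.symm.injective (AddMonoidHom.ext h)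

/-! ### The map `A(G) → R(G)` and the Burnside kernel -/

section Perm

variable {G : Type u} [Group G]

/-- The permutation representation `ℚ[X]` of a finite `G`-set `X`. -/
def FinGSet.perm (X : FinGSet G) : FinRep G :=
  haveI : Module.Finite ℚ (MonoidAlgebra ℚ X.carrier) :=
    Module.Finite.equiv (MonoidAlgebra.coeffLinearEquiv ℚ (S := ℚ) (M := X.carrier)).symm
  { carrier := MonoidAlgebra ℚ X.carrier
    rep := Representation.ofMulAction ℚ G X.carrier }

theorem FinGSet.perm_iso {X Y : FinGSet G} (h : X ≈ Y) : X.perm ≈ Y.perm := by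
  obtain ⟨e, he⟩ := h
  refine ⟨Representation.Equiv.mk (MonoidAlgebra.mapDomainLinearEquiv ℚ ℚ e) fun g => ?_⟩
  refine MonoidAlgebra.lhom_ext' fun x => LinearMap.ext fun r => ?_
  change MonoidAlgebra.mapDomainLinearEquiv ℚ ℚ e
      (Representation.ofMulAction ℚ G X.carrier g (MonoidAlgebra.single x r)) =
    Representation.ofMulAction ℚ G Y.carrier g
      (MonoidAlgebra.mapDomainLinearEquiv ℚ ℚ e (MonoidAlgebra.single x r))
  simp [he]

/-- The canonical isomorphism `ℚ[X ⊔ Y] ≃ ℚ[X] × ℚ[Y]`. -/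
def sumLinearEquiv (α β : Type u) :
    MonoidAlgebra ℚ (α ⊕ β) ≃ₗ[ℚ] MonoidAlgebra ℚ α × MonoidAlgebra ℚ β :=
  (MonoidAlgebra.coeffLinearEquiv ℚ).trans <|
    (Finsupp.sumFinsuppLEquivProdFinsupp ℚ).trans <|
      (MonoidAlgebra.coeffLinearEquiv ℚ).symm.prodCongr (MonoidAlgebra.coeffLinearEquiv ℚ).symm

theorem sumLinearEquiv_single_inl {α β : Type u} (x : α) (r : ℚ) :
    sumLinearEquiv α β (MonoidAlgebra.single (Sum.inl x) r) = (MonoidAlgebra.single x r, 0) := by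
  refine Prod.ext (MonoidAlgebra.ext ?_) (MonoidAlgebra.ext ?_)
  · refine Finsupp.ext fun y => ?_
    simp [sumLinearEquiv]
  · refine Finsupp.ext fun y => ?_
    simp [sumLinearEquiv]

theorem sumLinearEquiv_single_inr {α β : Type u} (x : β) (r : ℚ) :
    sumLinearEquiv α β (MonoidAlgebra.single (Sum.inr x) r) = (0, MonoidAlgebra.single x r) := by
  refine Prod.ext (MonoidAlgebra.ext ?_) (MonoidAlgebra.ext ?_)
  · refine Finsupp.ext fun y => ?_
    simp [sumLinearEquiv]
  · refine Finsupp.ext fun y => ?_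
    simp [sumLinearEquiv]

theorem FinGSet.perm_sum (X Y : FinGSet G) : (X.sum Y).perm ≈ X.perm.sum Y.perm := by
  refine ⟨Representation.Equiv.mk (sumLinearEquiv X.carrier Y.carrier) fun g => ?_⟩
  refine MonoidAlgebra.lhom_ext' fun (x : X.carrier ⊕ Y.carrier) => LinearMap.ext fun r => ?_
  change sumLinearEquiv X.carrier Y.carrier
      (Representation.ofMulAction ℚ G (X.carrier ⊕ Y.carrier) g (MonoidAlgebra.single x r)) =
    Prod.map (Representation.ofMulAction ℚ G X.carrier g)
      (Representation.ofMulAction ℚ G Y.carrier g)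
      (sumLinearEquiv X.carrier Y.carrier (MonoidAlgebra.single x r))
  rw [Representation.ofMulAction_single]
  obtain x | x := x
  · rw [Sum.smul_inl, sumLinearEquiv_single_inl, sumLinearEquiv_single_inl, Prod.map_apply,
      Representation.ofMulAction_single, map_zero]
  · rw [Sum.smul_inr, sumLinearEquiv_single_inr, sumLinearEquiv_single_inr, Prod.map_apply,
      Representation.ofMulAction_single, map_zero]

/-- The map `[X] ↦ [ℚ[X]]` on isomorphism classes. -/
def permHom (G : Type u) [Group G] : GSetClass G →+ RepClass G where
  toFun := Quotient.map FinGSet.perm fun _ _ h => FinGSet.perm_iso h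
  map_zero' := by
    have : Subsingleton (MonoidAlgebra ℚ PEmpty.{u + 1}) :=
      (MonoidAlgebra.coeffLinearEquiv ℚ).injective.subsingleton
    refine Quotient.sound ⟨Representation.Equiv.mk
      (LinearEquiv.ofBijective (0 : MonoidAlgebra ℚ PEmpty.{u + 1} →ₗ[ℚ] PUnit.{u + 1})
        ⟨fun _ _ _ => Subsingleton.elim _ _, fun _ => ⟨0, Subsingleton.elim _ _⟩⟩) fun g => ?_⟩
    exact LinearMap.ext fun x => Subsingleton.elim (α := PUnit.{u + 1}) _ _
  map_add' a b := by
    induction a, b using Quotient.inductionOn₂ with | _ X Y =>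
    exact Quotient.sound (FinGSet.perm_sum X Y)

theorem permHom_mk (X : FinGSet G) : permHom G (GSetClass.mk X) = RepClass.mk X.perm := rfl

/-- The natural map `f : A(G) → R(G)`, `[X] ↦ [ℚ[X]]`. -/
def burnsideToRep (G : Type u) [Group G] : BurnsideGroup G →+ RepGroup G :=
  grothMap (permHom G)

/-- The Burnside kernel `N(G)`. -/
def burnsideKernel (G : Type u) [Group G] : AddSubgroup (BurnsideGroup G) :=
  (burnsideToRep G).ker

end Perm

/-! ### The relative groups `A(G, H)`, `R(G, H)` and the relative Burnside kernel -/

section Relative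

/-- `X` is `H`-free: no nontrivial element of `H` fixes a point. -/
def FinGSet.IsHFree {G : Type u} {H : Type v} [Group G] [Group H] (X : FinGSet (G × H)) : Prop :=
  ∀ (h : H) (x : X.carrier), ((1, h) : G × H) • x = x → h = 1

/-- `V` is free as a `ℚ[H]`-module. -/
def FinRep.IsHFree {G : Type u} {H : Type v} [Group G] [Group H] (V : FinRep (G × H)) : Prop :=
  Module.Free (MonoidAlgebra ℚ H)
    (Representation.asModule (V.rep.comp (MonoidHom.inr G H)))

variable {G : Type u} {H : Type v} [Group G] [Group H]

theorem FinGSet.IsHFree.of_iso {X Y : FinGSet (G × H)} (hX : X.IsHFree) (h : X ≈ Y) :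
    Y.IsHFree := by
  obtain ⟨e, he⟩ := h
  intro h y hy
  refine hX h (e.symm y) (e.injective ?_)
  rw [he, Equiv.apply_symm_apply, hy]

theorem FinRep.IsHFree.of_iso {V W : FinRep (G × H)} (hV : V.IsHFree) (h : V ≈ W) :
    W.IsHFree := by
  obtain ⟨e⟩ := h
  unfold FinRep.IsHFree at hV ⊢
  let e' : Representation.Equiv (V.rep.comp (MonoidHom.inr G H))
      (W.rep.comp (MonoidHom.inr G H)) :=
    Representation.Equiv.mk e.toLinearEquiv fun h => e.toIntertwiningMap.isIntertwining' (1, h)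
  exact Module.Free.of_equiv (LinearEquiv.ofBijective
    (Representation.IntertwiningMap.equivLinearMapAsModule _ _ e'.toIntertwiningMap)
    e'.toLinearEquiv.bijective)

theorem FinRep.IsHFree.sum {V W : FinRep (G × H)} (hV : V.IsHFree) (hW : W.IsHFree) :
    (V.sum W).IsHFree := by
  let ρ : Representation ℚ H V.carrier := V.rep.comp (MonoidHom.inr G H)
  let σ : Representation ℚ H W.carrier := W.rep.comp (MonoidHom.inr G H)
  have : Module.Free (MonoidAlgebra ℚ H) ρ.asModule := hV
  have : Module.Free (MonoidAlgebra ℚ H) σ.asModule := hW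
  let φ : (ρ.prod σ).asModule →ₗ[MonoidAlgebra ℚ H] ρ.asModule × σ.asModule :=
    (Representation.IntertwiningMap.equivLinearMapAsModule _ _
      (Representation.IntertwiningMap.fst ℚ ρ σ)).prod
    (Representation.IntertwiningMap.equivLinearMapAsModule _ _
      (Representation.IntertwiningMap.snd ℚ ρ σ))
  have hφ : Function.Bijective φ := ⟨fun _ _ h => h, fun x => ⟨x, rfl⟩⟩
  have h2 : Module.Free (MonoidAlgebra ℚ H) (ρ.prod σ).asModule :=
    Module.Free.of_equiv (LinearEquiv.ofBijective φ hφ).symm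
  exact h2

/-- A transversal for a free action gives `ℚ[X]` as a free `ℚ[H]`-module. -/
theorem FinGSet.IsHFree.perm {X : FinGSet (G × H)} (hX : X.IsHFree) : X.perm.IsHFree := by
  classical
  let s : Setoid X.carrier := ⟨fun x y => ∃ h : H, ((1, h) : G × H) • x = y,
    fun x => ⟨1, one_smul _ x⟩,
    fun {x y} ⟨h, e⟩ => ⟨h⁻¹, by
      have h1 : ((1, h⁻¹) : G × H) = ((1, h) : G × H)⁻¹ := by ext <;> simp
      rw [← e, h1, inv_smul_smul]⟩,
    fun {x y z} ⟨h, e⟩ ⟨k, e'⟩ => ⟨k * h, by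
      have h1 : ((1, k * h) : G × H) = (1, k) * (1, h) := by ext <;> simp
      rw [h1, mul_smul, e, e']⟩⟩
  let Ω := Quotient s
  let θ : Ω × H → X.carrier := fun p => ((1, p.2) : G × H) • p.1.out
  have hmul : ∀ h k : H, ((1, h * k) : G × H) = (1, h) * (1, k) := fun h k => by ext <;> simp
  have hθ : Function.Bijective θ := by
    constructor
    · rintro ⟨a, h⟩ ⟨b, k⟩ hab
      change ((1, h) : G × H) • a.out = ((1, k) : G × H) • b.out at hab
      have h1 : ((1, k⁻¹ * h) : G × H) • a.out = b.out := by
        have h2 : ((1, k⁻¹) : G × H) = ((1, k) : G × H)⁻¹ := by ext <;> simp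
        rw [hmul, mul_smul, hab, h2, inv_smul_smul]
      have h3 : a = b := by
        rw [← a.out_eq, ← b.out_eq]
        exact Quotient.sound ⟨_, h1⟩
      subst h3
      have h4 := hX _ _ h1
      rw [inv_mul_eq_one] at h4
      rw [h4]
    · intro x
      obtain ⟨h, e⟩ := Quotient.exact (Quotient.out_eq (Quotient.mk s x))
      exact ⟨(Quotient.mk s x, h), e⟩
  let e : (Ω →₀ MonoidAlgebra ℚ H) ≃ₗ[ℚ] MonoidAlgebra ℚ X.carrier :=
    (Finsupp.mapRange.linearEquiv (MonoidAlgebra.coeffLinearEquiv ℚ)).trans <|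
      (Finsupp.curryLinearEquiv ℚ).symm.trans <|
        (Finsupp.domLCongr (Equiv.ofBijective θ hθ)).trans
          (MonoidAlgebra.coeffLinearEquiv ℚ).symm
  have he : ∀ (a : Ω) (h : H) (r : ℚ), e (Finsupp.single a (MonoidAlgebra.single h r)) =
      MonoidAlgebra.single (((1, h) : G × H) • a.out) r := by
    intro a h r
    simp [e, θ]
  let σ : Representation ℚ H (MonoidAlgebra ℚ X.carrier) :=
    (Representation.ofMulAction ℚ (G × H) X.carrier).comp (MonoidHom.inr G H)
  let e' : Representation.Equiv (Representation.free ℚ H Ω) σ :=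
    Representation.Equiv.mk e fun h => by
      refine Finsupp.lhom_ext' fun a => MonoidAlgebra.lhom_ext' fun k => LinearMap.ext fun r => ?_
      change e (Representation.free ℚ H Ω h (Finsupp.single a (MonoidAlgebra.single k r))) =
        Representation.ofMulAction ℚ (G × H) X.carrier (1, h)
          (e (Finsupp.single a (MonoidAlgebra.single k r)))
      rw [Representation.free_single_single, he, he, Representation.ofMulAction_single, hmul,
        mul_smul]
  have hfree := Representation.free_asModule_free ℚ H Ω
  have h2 : Module.Free (MonoidAlgebra ℚ H) σ.asModule :=
    Module.Free.of_equiv (LinearEquiv.ofBijective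
      (Representation.IntertwiningMap.equivLinearMapAsModule _ _ e'.toIntertwiningMap)
      e'.toLinearEquiv.bijective)
  exact h2

variable (G H)

/-- The monoid `S'` of isomorphism classes of finite `H`-free `G × H`-sets. -/
def freeGSetClass : AddSubmonoid (GSetClass (G × H)) where
  carrier := {a | ∃ X : FinGSet (G × H), X.IsHFree ∧ GSetClass.mk X = a}
  zero_mem' := ⟨FinGSet.empty _, fun _ x => x.elim, rfl⟩
  add_mem' := by
    rintro _ _ ⟨X, hX, rfl⟩ ⟨Y, hY, rfl⟩
    refine ⟨X.sum Y, ?_, rfl⟩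
    rintro h (x | y) hx
    · exact hX h x (Sum.inl_injective hx)
    · exact hY h y (Sum.inr_injective hx)

/-- The monoid `T'` of isomorphism classes of finitely generated `ℚ[H]`-free
`ℚ[G × H]`-modules. -/
def freeRepClass : AddSubmonoid (RepClass (G × H)) where
  carrier := {a | ∃ V : FinRep (G × H), V.IsHFree ∧ RepClass.mk V = a}
  zero_mem' := by
    refine ⟨FinRep.zero _, ?_, rfl⟩
    have : Subsingleton (Representation.asModule
      ((FinRep.zero (G × H)).rep.comp (MonoidHom.inr G H))) :=
      inferInstanceAs (Subsingleton PUnit)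
    exact Module.Free.of_subsingleton _ _
  add_mem' := by
    rintro _ _ ⟨V, hV, rfl⟩ ⟨W, hW, rfl⟩
    exact ⟨V.sum W, hV.sum hW, rfl⟩

variable {G H}

theorem mk_mem_freeGSetClass {X : FinGSet (G × H)} :
    GSetClass.mk X ∈ freeGSetClass G H ↔ X.IsHFree :=
  ⟨fun ⟨_, hY, h⟩ => hY.of_iso (Quotient.exact h), fun h => ⟨X, h, rfl⟩⟩

theorem mk_mem_freeRepClass {V : FinRep (G × H)} :
    RepClass.mk V ∈ freeRepClass G H ↔ V.IsHFree :=
  ⟨fun ⟨_, hW, h⟩ => hW.of_iso (Quotient.exact h), fun h => ⟨V, h, rfl⟩⟩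

theorem permHom_mem_free {a : GSetClass (G × H)} (ha : a ∈ freeGSetClass G H) :
    permHom (G × H) a ∈ freeRepClass G H := by
  obtain ⟨X, hX, rfl⟩ := ha
  exact ⟨X.perm, hX.perm, rfl⟩

variable (G H)

/-- The relative Burnside module `A(G, H)`. -/
abbrev RelBurnsideGroup : Type (max u v + 1) :=
  Algebra.GrothendieckAddGroup (freeGSetClass G H)

/-- The relative rational representation module `R(G, H)`. -/
abbrev RelRepGroup : Type (max u v + 1) :=
  Algebra.GrothendieckAddGroup (freeRepClass G H)

/-- The map `S' → T'`, `[X] ↦ [ℚ[X]]`. -/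
def relPermHom : freeGSetClass G H →+ freeRepClass G H :=
  ((permHom (G × H)).comp (freeGSetClass G H).subtype).codRestrict (freeRepClass G H)
    fun a => permHom_mem_free a.2

/-- The natural map `f' : A(G, H) → R(G, H)`. -/
def relBurnsideToRep : RelBurnsideGroup G H →+ RelRepGroup G H :=
  grothMap (relPermHom G H)

/-- The relative Burnside kernel `N(G, H)`. -/
def relBurnsideKernel : AddSubgroup (RelBurnsideGroup G H) :=
  (relBurnsideToRep G H).ker

/-- The inclusion `A(G, H) ⊆ A(G × H)`. -/
def relIncl : RelBurnsideGroup G H →+ BurnsideGroup (G × H) :=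
  grothMap (freeGSetClass G H).subtype

/-- The set of points on which `H` acts freely, as a `G × H`-set. -/
def freeLocus {G : Type u} {H : Type v} [Group G] [Group H] (X : FinGSet (G × H)) :
    FinGSet (G × H) :=
  letI : MulAction (G × H) {x : X.carrier // ∀ h : H, ((1, h) : G × H) • x = x → h = 1} :=
    { smul := fun g x => ⟨g • x.1, fun h hh => by
        have h1 : ((1, g.2⁻¹ * h * g.2) : G × H) • x.1 = x.1 := by
          have h2 : ((1, g.2⁻¹ * h * g.2) : G × H) = g⁻¹ * ((1, h) * g) := by
            ext <;> simp [mul_assoc]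
          rw [h2, mul_smul, mul_smul, hh, inv_smul_smul]
        have h3 := x.2 _ h1
        have h4 : h = g.2 * (g.2⁻¹ * h * g.2) * g.2⁻¹ := by group
        rw [h4, h3]
        group⟩
      one_smul := fun x => Subtype.ext (one_smul _ x.1)
      mul_smul := fun g h x => Subtype.ext (mul_smul g h x.1) }
  { carrier := {x : X.carrier // ∀ h : H, ((1, h) : G × H) • x = x → h = 1} }

theorem freeLocus_isHFree (X : FinGSet (G × H)) : (freeLocus X).IsHFree :=
  fun h x hx => x.2 h (congrArg Subtype.val hx)

/-- `[X] ↦ [freeLocus X]` on isomorphism classes. -/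
def freeLocusEnd : GSetClass (G × H) →+ GSetClass (G × H) :=
    { toFun := Quotient.map freeLocus (by
        rintro X Y ⟨e, he⟩
        refine ⟨e.subtypeEquiv fun x => ?_, fun g x => Subtype.ext (he g x.1)⟩
        refine forall_congr' fun h => ?_
        rw [← he, e.injective.eq_iff])
      map_zero' := Quotient.sound ⟨Equiv.subtypeUnivEquiv (α := PEmpty) fun x => x.elim,
        fun _ x => x.1.elim⟩
      map_add' := by
        intro a b
        induction a, b using Quotient.inductionOn₂ with | _ X Y =>
        refine Quotient.sound ⟨Equiv.ofBijective
          (fun x => match x with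
            | ⟨Sum.inl x, hx⟩ => Sum.inl ⟨x, fun h hh => hx h (congrArg Sum.inl hh)⟩
            | ⟨Sum.inr y, hy⟩ => Sum.inr ⟨y, fun h hh => hy h (congrArg Sum.inr hh)⟩)
          ⟨?_, ?_⟩, ?_⟩
        · rintro ⟨x | x, hx⟩ ⟨y | y, hy⟩ h
          · have h1 := Sum.inl_injective h
            exact Subtype.ext (congrArg (fun z => Sum.inl z.1) h1)
          · exact absurd h Sum.inl_ne_inr
          · exact absurd h Sum.inr_ne_inl
          · have h1 := Sum.inr_injective h
            exact Subtype.ext (congrArg (fun z => Sum.inr z.1) h1)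
        · rintro (⟨x, hx⟩ | ⟨y, hy⟩)
          · exact ⟨⟨Sum.inl x, fun h hh => hx h (Sum.inl_injective hh)⟩, rfl⟩
          · exact ⟨⟨Sum.inr y, fun h hh => hy h (Sum.inr_injective hh)⟩, rfl⟩
        · rintro g ⟨x | x, hx⟩ <;> rfl }

/-- Taking free loci is a retraction of `S` onto `S'`. -/
def freeLocusHom : GSetClass (G × H) →+ freeGSetClass G H :=
  (freeLocusEnd G H).codRestrict
    (freeGSetClass G H) (by
      intro a
      induction a using Quotient.inductionOn with | _ X =>
      exact ⟨freeLocus X, freeLocus_isHFree G H X, rfl⟩)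

theorem freeLocusHom_coe (a : freeGSetClass G H) : freeLocusHom G H a = a := by
  obtain ⟨_, X, hX, rfl⟩ := a
  exact Subtype.ext (Quotient.sound
    ⟨Equiv.subtypeUnivEquiv fun x h => hX h x, fun _ _ => rfl⟩)

theorem relIncl_injective : Function.Injective (relIncl G H) := by
  have h : (grothMap (freeLocusHom G H)).comp (relIncl G H) = AddMonoidHom.id _ :=
    groth_hom_ext fun a => by
      rw [AddMonoidHom.comp_apply, relIncl, grothMap_of, grothMap_of, AddMonoidHom.id_apply,
        AddSubmonoid.coe_subtype, freeLocusHom_coe]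
  exact Function.LeftInverse.injective (g := grothMap (freeLocusHom G H))
    fun x => DFunLike.congr_fun h x

end Relative

/-! ### Induction from subquotients -/

section Induction

/-- Pullback of a finite `Q`-set along a group homomorphism `K → Q`. -/
def FinGSet.pullback {K Q : Type u} [Group K] [Group Q] (φ : K →* Q) (X : FinGSet Q) :
    FinGSet K :=
  letI : MulAction K X.carrier := MulAction.compHom X.carrier φ
  { carrier := X.carrier }

/-- The pullback map `A(Q) → A(K)`. -/
def pullbackHom {K Q : Type u} [Group K] [Group Q] (φ : K →* Q) :
    BurnsideGroup Q →+ BurnsideGroup K :=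
  grothMap
    { toFun := Quotient.map (FinGSet.pullback φ) (by
        rintro X Y ⟨e, he⟩
        exact ⟨e, fun k x => he (φ k) x⟩)
      map_zero' := Quotient.sound ⟨Equiv.refl _, fun _ _ => rfl⟩
      map_add' := by
        intro a b
        induction a, b using Quotient.inductionOn₂ with | _ X Y =>
        refine Quotient.sound ⟨Equiv.refl _, ?_⟩
        rintro k (x | y) <;> rfl }

variable {G : Type u} [Group G]

/-- The relation `(g * l, x) ∼ (g, l • x)` on `G × X`, for `l ∈ L`. -/
def indSetoid (L : Subgroup G) (X : FinGSet L) : Setoid (G × X.carrier) where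
  r a b := ∃ l : L, a.1 = b.1 * l ∧ b.2 = l • a.2
  iseqv :=
    { refl := fun a => ⟨1, by simp, by simp⟩
      symm := by
        rintro a b ⟨l, h1, h2⟩
        exact ⟨l⁻¹, by simp [h1], by simp [h2]⟩
      trans := by
        rintro a b c ⟨l, h1, h2⟩ ⟨m, h3, h4⟩
        exact ⟨m * l, by simp [h1, h3, mul_assoc], by simp [h2, h4, mul_smul]⟩ }

/-- The induced `G`-set `G ×_L X`. -/
def FinGSet.ind [Finite G] (L : Subgroup G) (X : FinGSet L) : FinGSet G :=
  letI : MulAction G (Quotient (indSetoid L X)) :=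
    { smul := fun g => Quotient.map (fun a => (g * a.1, a.2)) (by
        rintro a b ⟨l, h1, h2⟩
        exact ⟨l, by simp [h1, mul_assoc], h2⟩)
      one_smul := fun q => by
        induction q using Quotient.inductionOn with | _ a =>
        exact congrArg (Quotient.mk _) (Prod.ext (one_mul _) rfl)
      mul_smul := fun g h q => by
        induction q using Quotient.inductionOn with | _ a =>
        exact congrArg (Quotient.mk _) (Prod.ext (mul_assoc _ _ _) rfl) }
  { carrier := Quotient (indSetoid L X)
    finite := Quotient.finite _ }

theorem FinGSet.ind_iso [Finite G] (L : Subgroup G) {X Y : FinGSet L} (h : X ≈ Y) :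
    X.ind L ≈ Y.ind L := by
  obtain ⟨e, he⟩ := h
  refine ⟨Quotient.congr ((Equiv.refl G).prodCongr e) ?_, ?_⟩
  · intro a b
    refine exists_congr fun l => and_congr Iff.rfl ?_
    change _ ↔ e b.2 = l • e a.2
    rw [← he, e.injective.eq_iff]
  · intro g q
    induction q using Quotient.inductionOn with | _ a =>
    rfl

theorem FinGSet.ind_sum [Finite G] (L : Subgroup G) (X Y : FinGSet L) :
    (X.sum Y).ind L ≈ (X.ind L).sum (Y.ind L) := by
  let φ : Quotient (indSetoid L (X.sum Y)) →
      Quotient (indSetoid L X) ⊕ Quotient (indSetoid L Y) :=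
    Quotient.lift (fun a : G × (X.carrier ⊕ Y.carrier) => match a with
      | (g, Sum.inl x) => Sum.inl (Quotient.mk (indSetoid L X) (g, x))
      | (g, Sum.inr y) => Sum.inr (Quotient.mk (indSetoid L Y) (g, y))) (by
      rintro ⟨g, x | x⟩ ⟨h, y | y⟩ ⟨l, h1, h2⟩
      · exact congrArg Sum.inl (Quotient.sound ⟨l, h1, Sum.inl_injective h2⟩)
      · exact absurd h2 Sum.inr_ne_inl
      · exact absurd h2 Sum.inl_ne_inr
      · exact congrArg Sum.inr (Quotient.sound ⟨l, h1, Sum.inr_injective h2⟩))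
  refine ⟨Equiv.ofBijective φ ⟨?_, ?_⟩, ?_⟩
  · intro p q
    induction p, q using Quotient.inductionOn₂ with | _ a b =>
    obtain ⟨g, x | x⟩ := a <;> obtain ⟨h, y | y⟩ := b <;> intro hab
    · obtain ⟨l, h1, h2⟩ := Quotient.exact (Sum.inl_injective hab)
      exact Quotient.sound ⟨l, h1, congrArg Sum.inl h2⟩
    · exact absurd hab Sum.inl_ne_inr
    · exact absurd hab Sum.inr_ne_inl
    · obtain ⟨l, h1, h2⟩ := Quotient.exact (Sum.inr_injective hab)
      exact Quotient.sound ⟨l, h1, congrArg Sum.inr h2⟩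
  · rintro (p | p) <;> induction p using Quotient.inductionOn with | _ a
    · exact ⟨Quotient.mk _ (a.1, Sum.inl a.2), rfl⟩
    · exact ⟨Quotient.mk _ (a.1, Sum.inr a.2), rfl⟩
  · intro g q
    induction q using Quotient.inductionOn with | _ a =>
    obtain ⟨h, x | x⟩ := a <;> rfl

/-- The induction map `L↑ : A(L) → A(G)`, `[X] ↦ [G ×_L X]`. -/
def indHom [Finite G] (L : Subgroup G) : BurnsideGroup L →+ BurnsideGroup G :=
  grothMap
    { toFun := Quotient.map (FinGSet.ind L) fun _ _ h => FinGSet.ind_iso L h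
      map_zero' := Quotient.sound
        ⟨{ toFun := fun q => (Quotient.out q).2.elim
           invFun := fun x => x.elim
           left_inv := fun q => (Quotient.out q).2.elim
           right_inv := fun x => x.elim }, fun _ q => (Quotient.out q).2.elim⟩
      map_add' := by
        intro a b
        induction a, b using Quotient.inductionOn₂ with | _ X Y =>
        exact Quotient.sound (FinGSet.ind_sum L X Y) }

/-- The induction map `L/C↑ : A(L/C) → A(G)` of the subquotient `L/C` of `G`, where `L ≤ G` and
`C` is a normal subgroup of `L`. -/
def subquotientInd [Finite G] (L : Subgroup G) (C : Subgroup L) [C.Normal] :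
    BurnsideGroup (L ⧸ C) →+ BurnsideGroup G :=
  (indHom L).comp (pullbackHom (QuotientGroup.mk' C))

end Induction

section RelativeInduction

variable {G : Type u} {H : Type v} [Group G] [Group H] [Finite G] [Finite H]

/-- `Ã(L/C)`: the elements of `A(L/C)` whose induction lands in `A(G, H)`. -/
def tildeBurnside (L : Subgroup (G × H)) (C : Subgroup L) [C.Normal] :
    AddSubgroup (BurnsideGroup (L ⧸ C)) :=
  (relIncl G H).range.comap (subquotientInd L C)

/-- `Ñ(L/C)`: the intersection of `N(L/C)` with `Ã(L/C)`. -/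
def tildeKernel (L : Subgroup (G × H)) (C : Subgroup L) [C.Normal] :
    AddSubgroup (BurnsideGroup (L ⧸ C)) :=
  burnsideKernel (L ⧸ C) ⊓ tildeBurnside L C

/-- The relative induction map `L/C↑ : Ã(L/C) → A(G, H)`, the restriction of the usual one. -/
def relInd (L : Subgroup (G × H)) (C : Subgroup L) [C.Normal] :
    tildeBurnside L C →+ RelBurnsideGroup G H :=
  (AddMonoidHom.ofInjective (relIncl_injective G H)).symm.toAddMonoidHom.comp
    (((subquotientInd L C).comp (tildeBurnside L C).subtype).codRestrict
      (relIncl G H).range fun x => x.2)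

theorem relIncl_relInd (L : Subgroup (G × H)) (C : Subgroup L) [C.Normal]
    (x : tildeBurnside L C) : relIncl G H (relInd L C x) = subquotientInd L C x :=
  congrArg Subtype.val ((AddMonoidHom.ofInjective (relIncl_injective G H)).apply_symm_apply
    ⟨subquotientInd L C x, x.2⟩)

/-- The induced kernel `L/C↑ Ñ(L/C)`, a subgroup of `A(G, H)`. -/
def inducedKernel (L : Subgroup (G × H)) (C : Subgroup L) [C.Normal] :
    AddSubgroup (RelBurnsideGroup G H) :=
  ((tildeKernel L C).addSubgroupOf (tildeBurnside L C)).map (relInd L C)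

end RelativeInduction

/-- `T` is the elementary abelian group `ℤ_p × ℤ_p`, a (nonabelian) dihedral group, or a nonabelian
group of order `p ^ 3` and exponent `p`. -/
def IsTornehaveGroup (p : ℕ) (T : Type) [Group T] : Prop :=
  Nonempty (T ≃* Multiplicative (ZMod p × ZMod p)) ∨
  (∃ n : ℕ, 3 ≤ n ∧ Nonempty (T ≃* DihedralGroup n)) ∨
  (Nat.card T = p ^ 3 ∧ Monoid.exponent T = p ∧ ∃ a b : T, a * b ≠ b * a)

end RelBurnside

end

/-! Write E = G × H, an elementary abelian p-group, and call D ≤ E free if D ∩ H = 1. The E/D with D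
free generate A(G,H). By character theory over ℚ, both kernels consist of the virtual sets on which
every group element has virtual fixed-point number zero (`mem_burnsideKernel_iff`,
`mem_relBurnsideKernel_iff`). Induction multiplies fixed-point numbers by [E:L] on L and kills them
off L. Hence induced kernels lie in N(G,H), and a kernel element supported on subgroups between C
and L comes from N(L/C) (`mem_inducedKernel_of_mem_closure`).

The only relation needed is that of rank two: if P/K ≅ ℤ_p², then E/K − ∑ E/l + p·E/P, with l
strictly between K and P, has no virtual fixed points. If P is free, this relation lives between K
and PH, of rank three over K. Since H has order p, it lets a free K be replaced by larger free
subgroups until the index is p or p² (`relCosetElt_mem_sup`). If K ≠ K' are free of index p² with KH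
= K'H = M, the rank two relations for E/K and E/K' have the same non-free terms, coming from M and
E. Their difference lies in A(G,H) and between K ∩ K' and E, again of rank three
(`relCosetElt_sub_mem`).

So modulo rank three, A(G,H) is spanned by the free subgroups of index p and one free K of index p²
for each product KH. Weighted sums of fixed-point numbers attached to subgroups of index p show that
no nonzero combination of these lies in the kernel (`hyperplaneHom_relCosetElt`), which gives the
first equality. The second has the same summands: L/C is abelian, which leaves only T = ℤ_p². -/

namespace RelBurnside
open Representation

/-! ### Characters of rational representations -/

section Characters

variable {K : Type*} [Group K] [Finite K]

/-- By Maschke, a surjective intertwining map splits. -/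
theorem nonempty_equiv_prod_ker {V W : Type*} [AddCommGroup V] [Module ℚ V]
    [Module.Finite ℚ V] [AddCommGroup W] [Module ℚ W] [Module.Finite ℚ W]
    {ρ : Representation ℚ K V} {σ : Representation ℚ K W} (f : IntertwiningMap ρ σ)
    (hf : Function.Surjective f) :
    Nonempty (ρ.Equiv (σ.prod f.ker.toRepresentation)) := by
  let κ := f.ker.toRepresentation
  let i : IntertwiningMap κ ρ := ⟨f.ker.toSubmodule.subtype, fun g => rfl⟩
  have hi : LinearMap.ker (IntertwiningMap.equivLinearMapAsModule κ ρ i) = ⊥ :=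
    LinearMap.ker_eq_bot.2 fun x y h => Subtype.ext h
  have : NeZero (Nat.card K : ℚ) := ⟨Nat.cast_ne_zero.2 Nat.card_pos.ne'⟩
  obtain ⟨r, hr⟩ := MonoidAlgebra.exists_leftInverse_of_injective _ hi
  let π : IntertwiningMap ρ κ := (IntertwiningMap.equivLinearMapAsModule ρ κ).symm r
  have hπ : ∀ x : f.ker.toSubmodule, π x.1 = x := fun x => LinearMap.congr_fun hr x
  let F : IntertwiningMap ρ (σ.prod κ) := f.prod π
  -- On the kernel of f the Maschke retraction π is the identity, so f and π have no common zero
  -- except 0.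
  have hinj : Function.Injective F.toLinearMap := by
    rw [injective_iff_map_eq_zero]
    intro v hv
    have h1 : f v = 0 := congrArg Prod.fst hv
    have h2 : π v = 0 := congrArg Prod.snd hv
    have h3 := hπ ⟨v, h1⟩
    rw [h2] at h3
    exact (congrArg Subtype.val h3).symm
  have hdim : Module.finrank ℚ V = Module.finrank ℚ (W × f.ker.toSubmodule) := by
    rw [Module.finrank_prod, ← LinearMap.finrank_range_add_finrank_ker f.toLinearMap,
      LinearMap.range_eq_top.2 hf, finrank_top]
    rfl
  exact ⟨IntertwiningMap.ofBijective F
    ⟨hinj, (LinearMap.injective_iff_surjective_of_finrank_eq_finrank hdim).1 hinj⟩⟩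

omit [Finite K] in
theorem character_prod {V W : Type*} [AddCommGroup V] [Module ℚ V]
    [Module.Finite ℚ V] [AddCommGroup W] [Module ℚ W] [Module.Finite ℚ W]
    (ρ : Representation ℚ K V) (σ : Representation ℚ K W) (g : K) :
    (ρ.prod σ).character g = ρ.character g + σ.character g :=
  LinearMap.trace_prodMap' (ρ g) (σ g)

/-- Rational representations of a finite group with the same character are isomorphic. -/
theorem nonempty_equiv_of_character_eq {V W : Type*} [AddCommGroup V] [Module ℚ V]
    [Module.Finite ℚ V] [AddCommGroup W] [Module ℚ W] [Module.Finite ℚ W]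
    (ρ : Representation ℚ K V) (σ : Representation ℚ K W) (h : ρ.character = σ.character) :
    Nonempty (ρ.Equiv σ) := by
  induction hn : Module.finrank ℚ V using Nat.strong_induction_on generalizing V W with
  | _ n ih =>
  subst hn
  have hdim : Module.finrank ℚ V = Module.finrank ℚ W := by
    have := congrFun h 1
    rw [char_one, char_one] at this
    exact_mod_cast this
  have := Fintype.ofFinite K
  have : Invertible (Nat.card K : ℚ) := invertibleOfNonzero (Nat.cast_ne_zero.2 Nat.card_pos.ne')
  obtain hV | hV := subsingleton_or_nontrivial V
  · have hW : Subsingleton W := by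
      rw [← Module.finrank_zero_iff (R := ℚ), ← hdim, Module.finrank_zero_iff]; exact hV
    exact ⟨Representation.Equiv.mk (LinearEquiv.ofFinrankEq V W hdim)
      fun g => LinearMap.ext fun x => Subsingleton.elim _ _⟩
  -- The pairing of characters is the dimension of the Hom space over any field of characteristic
  -- zero, so neither irreducibility nor a splitting field is needed. Hom(ρ, ρ) contains the
  -- identity, hence Hom(ρ, σ) is nonzero too.
  have hhom : Module.finrank ℚ (IntertwiningMap ρ ρ) = Module.finrank ℚ (IntertwiningMap ρ σ) := by
    have h1 := card_inv_mul_sum_char_mul_char_eq_finrank ρ ρ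
    have h2 := card_inv_mul_sum_char_mul_char_eq_finrank ρ σ
    rw [← h, h1] at h2
    exact_mod_cast h2
  have hfin : ∀ {U : Type _} [AddCommGroup U] [Module ℚ U] [Module.Finite ℚ U]
      (τ : Representation ℚ K U), Module.Finite ℚ (IntertwiningMap ρ τ) := fun τ =>
    Module.Finite.equiv (invariantsEquivIntertwiningMap ρ τ)
  have hne : Nontrivial (IntertwiningMap ρ σ) := by
    have := hfin ρ
    have h1 : Nontrivial (IntertwiningMap ρ ρ) := by
      obtain ⟨v, hv⟩ := exists_ne (0 : V)
      exact ⟨IntertwiningMap.id ρ, 0, fun h0 => hv (DFunLike.congr_fun h0 v)⟩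
    have h2 : 0 < Module.finrank ℚ (IntertwiningMap ρ ρ) := Module.finrank_pos
    rw [hhom] at h2
    exact Module.nontrivial_of_finrank_pos h2
  obtain ⟨f, hf⟩ := exists_ne (0 : IntertwiningMap ρ σ)
  -- The image of f is a quotient of ρ and, by Maschke, also of σ. Splitting it off both leaves
  -- kernels with equal characters, and f ≠ 0 makes the dimension drop.
  let τ := f.range.toRepresentation
  let f' : IntertwiningMap ρ τ := ⟨f.toLinearMap.rangeRestrict, fun g => by
    ext v
    exact IntertwiningMap.isIntertwining _ _ f g v⟩
  have hf' : Function.Surjective f' := fun ⟨y, x, hx⟩ => ⟨x, Subtype.ext hx⟩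
  let i : IntertwiningMap τ σ := ⟨f.range.toSubmodule.subtype, fun g => rfl⟩
  have hi : LinearMap.ker (IntertwiningMap.equivLinearMapAsModule τ σ i) = ⊥ :=
    LinearMap.ker_eq_bot.2 fun x y h => Subtype.ext h
  have : NeZero (Nat.card K : ℚ) := ⟨Nat.cast_ne_zero.2 Nat.card_pos.ne'⟩
  obtain ⟨r, hr⟩ := MonoidAlgebra.exists_leftInverse_of_injective _ hi
  let π : IntertwiningMap σ τ := (IntertwiningMap.equivLinearMapAsModule σ τ).symm r
  have hπ : Function.Surjective π := fun x => ⟨i x, LinearMap.congr_fun hr x⟩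
  obtain ⟨e1⟩ := nonempty_equiv_prod_ker f' hf'
  obtain ⟨e2⟩ := nonempty_equiv_prod_ker π hπ
  have hchar : f'.ker.toRepresentation.character = π.ker.toRepresentation.character := by
    funext g
    have h1 := congrFun (char_iso e1) g
    have h2 := congrFun (char_iso e2) g
    rw [character_prod] at h1 h2
    rw [h, h2] at h1
    exact (add_left_cancel h1).symm
  have hlt : Module.finrank ℚ f'.ker.toSubmodule < Module.finrank ℚ V := by
    refine Submodule.finrank_lt fun htop => hf ?_
    refine IntertwiningMap.ext (LinearMap.ext fun v => ?_)
    have hv : v ∈ f'.ker.toSubmodule := htop ▸ Submodule.mem_top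
    exact congrArg Subtype.val (show f' v = 0 from hv)
  obtain ⟨e3⟩ := ih _ hlt _ _ hchar rfl
  refine ⟨(e1.trans (Representation.Equiv.mk
    ((LinearEquiv.refl ℚ _).prodCongr e3.toLinearEquiv) fun g => ?_)).trans e2.symm⟩
  refine LinearMap.ext fun x => Prod.ext rfl ?_
  exact LinearMap.congr_fun (e3.toIntertwiningMap.isIntertwining' g) x.2

omit [Finite K] in
-- In the basis of points g is a permutation matrix, with a diagonal 1 exactly at each fixed point.
theorem character_ofMulAction {X : Type*} [MulAction K X] [Finite X] (g : K) :
    (Representation.ofMulAction ℚ K X).character g = Nat.card (MulAction.fixedBy X g) := by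
  classical
  have := Fintype.ofFinite X
  let b : Module.Basis X ℚ (MonoidAlgebra ℚ X) := ⟨MonoidAlgebra.coeffLinearEquiv ℚ⟩
  have hb : ∀ x, b x = MonoidAlgebra.single x 1 := fun x => rfl
  have hr : ∀ f x, b.repr f x = f.coeff x := fun f x => rfl
  rw [Representation.character, LinearMap.trace_eq_matrix_trace ℚ b, Matrix.trace]
  simp only [Matrix.diag_apply, LinearMap.toMatrix_apply, hb, hr,
    Representation.ofMulAction_single, MonoidAlgebra.coeff_single, Finsupp.single_apply]
  rw [Finset.sum_boole, Nat.card_eq_fintype_card, Fintype.card_subtype]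
  rfl

end Characters
end RelBurnside

namespace RelBurnside
open Algebra (GrothendieckAddGroup)

/-! ### Detecting the kernels by fixed points -/

section FixedPoints

/-- Every element of a Grothendieck group is a difference of two classes. -/
theorem groth_exists_sub {M : Type*} [AddCommMonoid M] (x : GrothendieckAddGroup M) :
    ∃ a b : M, x = GrothendieckAddGroup.of a - GrothendieckAddGroup.of b := by
  obtain ⟨⟨a, b⟩, h⟩ := (AddLocalization.addMonoidOf (⊤ : AddSubmonoid M)).surj x
  exact ⟨a, b, eq_sub_of_add_eq h⟩

variable (K : Type u) [Group K]

/-- The number of fixed points of `g`, on isomorphism classes of `K`-sets. -/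
noncomputable def fixClassHom (g : K) : GSetClass K →+ ℤ where
  toFun := Quotient.lift (fun X : FinGSet K => (Nat.card (MulAction.fixedBy X.carrier g) : ℤ)) (by
    rintro X Y ⟨e, he⟩
    refine congrArg Nat.cast (Nat.card_congr (e.subtypeEquiv fun x => ?_))
    rw [MulAction.mem_fixedBy, MulAction.mem_fixedBy, ← he, e.injective.eq_iff])
  map_zero' := by
    have : IsEmpty (MulAction.fixedBy (FinGSet.empty K).carrier g) := ⟨fun x => x.1.elim⟩
    exact congrArg Nat.cast Nat.card_of_isEmpty
  map_add' a b := by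
    induction a, b using Quotient.inductionOn₂ with | _ X Y =>
    change (Nat.card (MulAction.fixedBy (X.carrier ⊕ Y.carrier) g) : ℤ) =
      Nat.card (MulAction.fixedBy X.carrier g) + Nat.card (MulAction.fixedBy Y.carrier g)
    rw [← Nat.cast_add, ← Nat.card_sum]
    refine congrArg Nat.cast (Nat.card_congr
      ((Equiv.subtypeSum).trans (Equiv.sumCongr
        (Equiv.subtypeEquivRight fun x => Sum.inl_injective.eq_iff)
        (Equiv.subtypeEquivRight fun x => Sum.inr_injective.eq_iff))))

/-- The number of fixed points of `g`, as a homomorphism `A(K) → ℤ`. -/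
noncomputable def fixHom (g : K) : BurnsideGroup K →+ ℤ := GrothendieckAddGroup.lift (fixClassHom K g)

/-- The character value at `g`, on isomorphism classes of representations. -/
noncomputable def charClassHom (g : K) : RepClass K →+ ℚ where
  toFun := Quotient.lift (fun V : FinRep K => V.rep.character g) (by
    rintro V W ⟨e⟩
    exact congrFun (Representation.char_iso e) g)
  map_zero' := by
    change LinearMap.trace ℚ (FinRep.zero K).carrier ((FinRep.zero K).rep g) = 0
    rw [show ((FinRep.zero K).rep g) = 0 from LinearMap.ext fun x => rfl, map_zero]
  map_add' a b := by
    induction a, b using Quotient.inductionOn₂ with | _ V W =>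
    exact character_prod V.rep W.rep g

variable {K}

theorem lift_of {M A : Type*} [AddCommMonoid M] [AddCommGroup A] (φ : M →+ A) (m : M) :
    GrothendieckAddGroup.lift φ (GrothendieckAddGroup.of m) = φ m :=
  DFunLike.congr_fun (GrothendieckAddGroup.lift.symm_apply_apply φ) m

theorem fixHom_of (g : K) (X : FinGSet K) :
    fixHom K g (GrothendieckAddGroup.of (GSetClass.mk X)) =
      Nat.card (MulAction.fixedBy X.carrier g) :=
  lift_of _ _

theorem charClassHom_permHom (g : K) (a : GSetClass K) :
    charClassHom K g (permHom K a) = fixClassHom K g a := by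
  induction a using Quotient.inductionOn with | _ X =>
  exact character_ofMulAction g

/-- The two permutation characters agree. The conclusion already holds in the monoid of classes,
which is what makes it usable for A(G,H) as well. -/
theorem permHom_eq_of_fixClassHom_eq [Finite K] {a b : GSetClass K}
    (h : ∀ g, fixClassHom K g a = fixClassHom K g b) : permHom K a = permHom K b := by
  induction a, b using Quotient.inductionOn₂ with | _ X Y =>
  refine Quotient.sound (nonempty_equiv_of_character_eq X.perm.rep Y.perm.rep (funext fun g => ?_))
  have h1 := charClassHom_permHom g (GSetClass.mk X)
  have h2 := charClassHom_permHom g (GSetClass.mk Y)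
  exact (h1.trans (congrArg Int.cast (h g))).trans h2.symm

/-- The Burnside kernel consists of the virtual `K`-sets on which every element has (virtually)
no fixed point. -/
theorem mem_burnsideKernel_iff [Finite K] (x : BurnsideGroup K) :
    x ∈ burnsideKernel K ↔ ∀ g, fixHom K g x = 0 := by
  refine ⟨fun hx g => ?_, fun hx => ?_⟩
  · have h : ((GrothendieckAddGroup.lift (charClassHom K g)).comp (burnsideToRep K)) =
        (Int.castAddHom ℚ).comp (fixHom K g) := groth_hom_ext fun a => by
      simp only [AddMonoidHom.comp_apply, burnsideToRep, grothMap_of, lift_of, fixHom]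
      exact charClassHom_permHom g a
    have h1 := DFunLike.congr_fun h x
    rw [AddMonoidHom.comp_apply, show burnsideToRep K x = 0 from hx, map_zero] at h1
    exact Int.cast_eq_zero.1 h1.symm
  · obtain ⟨a, b, rfl⟩ := groth_exists_sub x
    change burnsideToRep K _ = 0
    rw [map_sub, burnsideToRep, grothMap_of, grothMap_of, sub_eq_zero,
      permHom_eq_of_fixClassHom_eq fun g => ?_]
    have := hx g
    rwa [map_sub, fixHom, lift_of, lift_of, sub_eq_zero] at this

end FixedPoints

section RelFixedPoints

variable {G : Type u} {H : Type v} [Group G] [Group H] [Finite G] [Finite H]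

/-- The relative Burnside kernel is also detected by fixed points. -/
theorem mem_relBurnsideKernel_iff (x : RelBurnsideGroup G H) :
    x ∈ relBurnsideKernel G H ↔ ∀ g, fixHom (G × H) g (relIncl G H x) = 0 := by
  refine ⟨fun hx g => ?_, fun hx => ?_⟩
  · have h : ((GrothendieckAddGroup.lift ((charClassHom (G × H) g).comp
          (freeRepClass G H).subtype)).comp (relBurnsideToRep G H)) =
        (Int.castAddHom ℚ).comp ((fixHom (G × H) g).comp (relIncl G H)) :=
      groth_hom_ext fun a => by
        simp only [AddMonoidHom.comp_apply, relBurnsideToRep, relIncl, grothMap_of, lift_of, fixHom]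
        exact charClassHom_permHom g a.1
    have h1 := DFunLike.congr_fun h x
    rw [AddMonoidHom.comp_apply, show relBurnsideToRep G H x = 0 from hx, map_zero] at h1
    exact Int.cast_eq_zero.1 h1.symm
  · obtain ⟨a, b, rfl⟩ := groth_exists_sub x
    change relBurnsideToRep G H _ = 0
    rw [map_sub, relBurnsideToRep, grothMap_of, grothMap_of, sub_eq_zero]
    -- Since the classes agree in the large monoid, they agree in the submonoid of free modules;
    -- injectivity of R(G,H) → R(G×H) is not needed.
    refine congrArg _ (Subtype.ext (permHom_eq_of_fixClassHom_eq fun g => ?_))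
    have := hx g
    rwa [relIncl, map_sub, map_sub, grothMap_of, grothMap_of, fixHom, lift_of, lift_of,
      sub_eq_zero] at this

end RelFixedPoints
end RelBurnside

namespace RelBurnside
open Algebra (GrothendieckAddGroup)

/-! ### Transitive sets and induction -/

section Transitive

/-- The class of the transitive `K`-set `K / D`. -/
noncomputable def cosetClass {K : Type u} [Group K] [Finite K] (D : Subgroup K) : GSetClass K :=
  GSetClass.mk { carrier := K ⧸ D }

/-- The element `[K / D]` of the Burnside group. -/
noncomputable def cosetElt {K : Type u} [Group K] [Finite K] (D : Subgroup K) : BurnsideGroup K :=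
  GrothendieckAddGroup.of (cosetClass D)

/-- A finite `K`-set is the disjoint union of its orbits. -/
theorem exists_multiset_orbits {K : Type u} [Group K] [Finite K] (X : FinGSet K) :
    ∃ s : Multiset (Subgroup K), (∀ D ∈ s, ∃ x : X.carrier, MulAction.stabilizer K x = D) ∧
      GSetClass.mk X = (s.map cosetClass).sum := by
  induction hn : Nat.card X.carrier using Nat.strong_induction_on generalizing X with
  | _ n ih =>
  subst hn
  obtain hX | ⟨⟨x⟩⟩ := isEmpty_or_nonempty X.carrier
  · refine ⟨0, fun D hD => absurd hD (Multiset.notMem_zero D), ?_⟩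
    exact Quotient.sound ⟨⟨fun y => (hX.false y).elim, fun y => y.elim,
      fun y => (hX.false y).elim, fun y => y.elim⟩, fun _ y => (hX.false y).elim⟩
  -- The complement of the orbit of x is stable and misses x, so the induction hypothesis applies to
  -- it.
  let S : SubMulAction K X.carrier :=
    { carrier := (MulAction.orbit K x)ᶜ
      smul_mem' := fun g y hy ⟨k, hk⟩ => hy ⟨g⁻¹ * k, by
        change k • x = g • y at hk
        change (g⁻¹ * k) • x = y
        rw [mul_smul, hk, inv_smul_smul]⟩ }
  let Y : FinGSet K := { carrier := S }
  have hlt : Nat.card Y.carrier < Nat.card X.carrier :=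
    Finite.card_subtype_lt (p := fun y => y ∈ S) (x := x)
      (fun h => h (MulAction.mem_orbit_self x))
  obtain ⟨s, hs, hY⟩ := ih _ hlt Y rfl
  refine ⟨MulAction.stabilizer K x ::ₘ s, ?_, ?_⟩
  · intro D hD
    obtain rfl | hD := Multiset.mem_cons.1 hD
    · exact ⟨x, rfl⟩
    · obtain ⟨y, rfl⟩ := hs D hD
      exact ⟨y.1, (SubMulAction.stabilizer_of_subMul y).symm⟩
  · rw [Multiset.map_cons, Multiset.sum_cons, ← hY]
    classical
    let e : (K ⧸ MulAction.stabilizer K x) ⊕ S ≃ X.carrier :=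
      (Equiv.sumCongr (MulAction.orbitEquivQuotientStabilizer K x).symm (Equiv.refl _)).trans
        (Equiv.Set.sumCompl (MulAction.orbit K x))
    refine (Quotient.sound ⟨e, ?_⟩ : GSetClass.mk (FinGSet.sum { carrier := _ } Y) = _).symm
    rintro g (q | y)
    · induction q using QuotientGroup.induction_on with | _ k =>
      have he : ∀ k : K, e (Sum.inl (k : K ⧸ MulAction.stabilizer K x)) = k • x := fun k =>
        rfl
      exact (he (g * k)).trans ((mul_smul g k x).trans (congrArg (g • ·) (he k).symm))
    · rfl

theorem mem_closure_cosetElt {K : Type u} [Group K] [Finite K] (x : BurnsideGroup K) :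
    x ∈ AddSubgroup.closure (Set.range (cosetElt (K := K))) := by
  have h : ∀ a : GSetClass K, GrothendieckAddGroup.of a ∈
      AddSubgroup.closure (Set.range (cosetElt (K := K))) := fun a => by
    induction a using Quotient.inductionOn with | _ X =>
    obtain ⟨s, -, hs⟩ := exists_multiset_orbits X
    change GrothendieckAddGroup.of (GSetClass.mk X) ∈ _
    rw [hs, map_multiset_sum, Multiset.map_map]
    refine AddSubgroup.multiset_sum_mem _ _ fun y hy => ?_
    obtain ⟨D, -, rfl⟩ := Multiset.mem_map.1 hy
    exact AddSubgroup.subset_closure ⟨D, rfl⟩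
  obtain ⟨a, b, rfl⟩ := groth_exists_sub x
  exact sub_mem (h a) (h b)

open Classical in
-- By commutativity every point of K/D has stabilizer D, so g fixes all points or none.
theorem fixHom_cosetElt {K : Type u} [CommGroup K] [Finite K] (g : K) (D : Subgroup K) :
    fixHom K g (cosetElt D) = if g ∈ D then (D.index : ℤ) else 0 := by
  refine (fixHom_of g _).trans ?_
  have key : ∀ q : K ⧸ D, g • q = q ↔ g ∈ D := fun q => by
    induction q using QuotientGroup.induction_on with | _ k =>
    change ((g * k : K) : K ⧸ D) = k ↔ _
    rw [eq_comm, QuotientGroup.eq, mul_comm g, inv_mul_cancel_left]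
  split_ifs with h
  · exact congrArg Nat.cast (Nat.card_congr (Equiv.subtypeUnivEquiv fun q => (key q).2 h))
  · have : IsEmpty (MulAction.fixedBy (K ⧸ D) g) := ⟨fun q => h ((key q.1).1 q.2)⟩
    exact congrArg Nat.cast Nat.card_of_isEmpty

/-- Inducing the transitive set `(L / C) / D` gives the quotient by the preimage of `D`. -/
theorem subquotientInd_cosetElt {K : Type u} [Group K] [Finite K] (L : Subgroup K)
    (C : Subgroup L) [C.Normal] (D : Subgroup (L ⧸ C)) :
    subquotientInd L C (cosetElt D) =
      cosetElt ((D.comap (QuotientGroup.mk' C)).map L.subtype) := by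
  let D' := (D.comap (QuotientGroup.mk' C)).map L.subtype
  let X : FinGSet L := FinGSet.pullback (QuotientGroup.mk' C) { carrier := (L ⧸ C) ⧸ D }
  -- The base coset; an element of L fixes it exactly when it lies in the preimage D' of D, so g ↦
  -- [g, x₀] identifies K/D' with the induced set.
  let x₀ : X.carrier := ((1 : L ⧸ C) : (L ⧸ C) ⧸ D)
  have hx₀ : ∀ l : L, l • x₀ = x₀ ↔ (l : K) ∈ D' := fun l => by
    change (((l : L ⧸ C) * 1 : L ⧸ C) : (L ⧸ C) ⧸ D) = ((1 : L ⧸ C) : (L ⧸ C) ⧸ D) ↔ _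
    rw [eq_comm, QuotientGroup.eq, inv_one, one_mul, mul_one]
    exact (Subgroup.mem_map_iff_mem L.subtype_injective
      (K := D.comap (QuotientGroup.mk' C)) (x := l)).symm
  have h : cosetClass D' = GSetClass.mk (X.ind L) := by
    let φ : K ⧸ D' → Quotient (indSetoid L X) :=
      Quotient.lift (fun g => Quotient.mk (indSetoid L X) (g, x₀)) (by
        intro a b hab
        rw [← Quotient.eq_iff_equiv] at hab
        obtain ⟨l, hl, h⟩ := QuotientGroup.eq.1 hab
        refine Quotient.sound ⟨l⁻¹, ?_, ?_⟩
        · have h1 : (l : K) = a⁻¹ * b := h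
          change a = b * ((l⁻¹ : L) : K)
          rw [Subgroup.coe_inv, h1]
          group
        · exact ((hx₀ l⁻¹).2 (by
            rw [Subgroup.coe_inv]; exact inv_mem ⟨l, hl, rfl⟩)).symm)
    refine Quotient.sound ⟨Equiv.ofBijective φ ⟨?_, ?_⟩, ?_⟩
    · intro a b
      induction a using QuotientGroup.induction_on with | _ a =>
      induction b using QuotientGroup.induction_on with | _ b =>
      intro hab
      obtain ⟨l, h1, h2⟩ := Quotient.exact hab
      refine (QuotientGroup.eq.2 ?_).symm
      have h3 : b⁻¹ * a = l := by
        have h1 : a = b * l := h1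
        rw [h1, inv_mul_cancel_left]
      rw [h3]
      exact (hx₀ l).1 h2.symm
    · intro q
      induction q using Quotient.inductionOn with | _ a =>
      obtain ⟨g, x⟩ := a
      obtain ⟨y, rfl⟩ := QuotientGroup.mk_surjective (x : (L ⧸ C) ⧸ D)
      obtain ⟨l, rfl⟩ := QuotientGroup.mk_surjective y
      refine ⟨((g * l : K) : K ⧸ D'), Quotient.sound ⟨l, rfl, ?_⟩⟩
      change (((l : L ⧸ C)) : (L ⧸ C) ⧸ D) = (((l : L ⧸ C) * 1 : L ⧸ C) : (L ⧸ C) ⧸ D)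
      rw [mul_one]
    · intro g q
      induction q using QuotientGroup.induction_on with | _ k =>
      rfl
  change _ = GrothendieckAddGroup.of (cosetClass D')
  rw [h, subquotientInd, AddMonoidHom.comp_apply, pullbackHom, cosetElt, grothMap_of, indHom,
    grothMap_of]
  rfl

/-- Both sides are additive, so transitive sets suffice; there the preimage of D has index
[K:L]·[L/C:D]. -/
theorem fixHom_subquotientInd_of_mem {K : Type u} [CommGroup K] [Finite K] (L : Subgroup K)
    (C : Subgroup L) [C.Normal] (g : L) (x : BurnsideGroup (L ⧸ C)) :
    fixHom K g (subquotientInd L C x) = L.index * fixHom (L ⧸ C) g x := by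
  classical
  suffices h : (fixHom K g).comp (subquotientInd L C) =
      (AddMonoidHom.mulLeft (L.index : ℤ)).comp (fixHom (L ⧸ C) g) from DFunLike.congr_fun h x
  refine AddMonoidHom.eq_of_eqOn_dense (s := Set.range cosetElt)
    (eq_top_iff.2 fun y _ => mem_closure_cosetElt y) ?_
  rintro _ ⟨D, rfl⟩
  rw [AddMonoidHom.comp_apply, subquotientInd_cosetElt, AddMonoidHom.comp_apply, fixHom_cosetElt,
    fixHom_cosetElt, AddMonoidHom.coe_mulLeft, Subgroup.index_map_subtype,
    Subgroup.index_comap_of_surjective _ (QuotientGroup.mk'_surjective C)]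
  have h : (g : K) ∈ (D.comap (QuotientGroup.mk' C)).map L.subtype ↔ (g : L ⧸ C) ∈ D :=
    Subgroup.mem_map_iff_mem L.subtype_injective (x := g)
  simp only [h]
  split_ifs
  · push_cast; ring
  · simp

theorem fixHom_subquotientInd_of_notMem {K : Type u} [CommGroup K] [Finite K] (L : Subgroup K)
    (C : Subgroup L) [C.Normal] {g : K} (hg : g ∉ L) (x : BurnsideGroup (L ⧸ C)) :
    fixHom K g (subquotientInd L C x) = 0 := by
  classical
  suffices h : (fixHom K g).comp (subquotientInd L C) = 0 from DFunLike.congr_fun h x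
  refine AddMonoidHom.eq_of_eqOn_dense (s := Set.range cosetElt)
    (eq_top_iff.2 fun y _ => mem_closure_cosetElt y) ?_
  rintro _ ⟨D, rfl⟩
  rw [AddMonoidHom.comp_apply, subquotientInd_cosetElt, fixHom_cosetElt, if_neg]
  · rfl
  · exact fun h => hg (Subgroup.map_subtype_le _ h)

end Transitive

/-! ### Free transitive sets and induced kernels -/

section RelTransitive

variable {G : Type u} {H : Type v} [CommGroup G] [CommGroup H] [Finite G] [Finite H]

/-- A subgroup of `G × H` meeting `H` trivially. -/
def IsFreeSubgroup (D : Subgroup (G × H)) : Prop := ∀ h : H, ((1, h) : G × H) ∈ D → h = 1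

/-- The class in `A(G, H)` of the `H`-free part of `(G × H) / D`. -/
noncomputable def relCosetElt (D : Subgroup (G × H)) : RelBurnsideGroup G H :=
  grothMap (freeLocusHom G H) (cosetElt D)

omit [Finite G] [Finite H] in
theorem grothMap_freeLocusHom_relIncl (x : RelBurnsideGroup G H) :
    grothMap (freeLocusHom G H) (relIncl G H x) = x := by
  have h : (grothMap (freeLocusHom G H)).comp (relIncl G H) = AddMonoidHom.id _ :=
    groth_hom_ext fun a => by
      rw [AddMonoidHom.comp_apply, relIncl, grothMap_of, grothMap_of, AddMonoidHom.id_apply,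
        AddSubmonoid.coe_subtype, freeLocusHom_coe]
  exact DFunLike.congr_fun h x

/-- Every point of (G×H)/D has stabilizer D, so for free D passing to the free locus loses nothing.
-/
theorem relIncl_relCosetElt {D : Subgroup (G × H)} (hD : IsFreeSubgroup D) :
    relIncl G H (relCosetElt D) = cosetElt D := by
  have hfree : FinGSet.IsHFree (G := G) (H := H) { carrier := (G × H) ⧸ D } := by
    intro h q hq
    induction q using QuotientGroup.induction_on with | _ k =>
    refine hD h ?_
    have h1 : (((1, h) * k : G × H) : (G × H) ⧸ D) = k := hq
    rwa [eq_comm, QuotientGroup.eq, mul_comm (1, h) k, inv_mul_cancel_left] at h1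
  have h1 : cosetElt D = relIncl G H
      (GrothendieckAddGroup.of ⟨cosetClass D, mk_mem_freeGSetClass.2 hfree⟩) := by
    rw [relIncl, grothMap_of]
    rfl
  rw [relCosetElt, h1, grothMap_freeLocusHom_relIncl]

theorem mem_closure_relCosetElt (x : RelBurnsideGroup G H) :
    x ∈ AddSubgroup.closure (relCosetElt '' {D : Subgroup (G × H) | IsFreeSubgroup D}) := by
  have h : ∀ a : freeGSetClass G H, GrothendieckAddGroup.of a ∈
      AddSubgroup.closure (relCosetElt '' {D : Subgroup (G × H) | IsFreeSubgroup D}) := by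
    rintro ⟨_, X, hX, rfl⟩
    obtain ⟨s, hs, hXs⟩ := exists_multiset_orbits X
    -- Writing the element as the retraction of itself moves it to A(G×H), where the orbit
    -- decomposition is available; stabilizers of points of a free set are free.
    rw [← grothMap_freeLocusHom_relIncl (GrothendieckAddGroup.of _), relIncl, grothMap_of]
    change grothMap _ (GrothendieckAddGroup.of (GSetClass.mk X)) ∈ _
    rw [hXs, map_multiset_sum, map_multiset_sum, Multiset.map_map, Multiset.map_map]
    refine AddSubgroup.multiset_sum_mem _ _ fun y hy => ?_
    obtain ⟨D, hD, rfl⟩ := Multiset.mem_map.1 hy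
    obtain ⟨x, rfl⟩ := hs D hD
    exact AddSubgroup.subset_closure ⟨_, fun h hh => hX h x hh, rfl⟩
  obtain ⟨a, b, rfl⟩ := groth_exists_sub x
  exact sub_mem (h a) (h b)

/-- The condition defining Ã(L/C) holds automatically for an element whose induction comes from
A(G,H). -/
theorem mem_inducedKernel_iff (L : Subgroup (G × H)) (C : Subgroup L) [C.Normal]
    (x : RelBurnsideGroup G H) :
    x ∈ inducedKernel L C ↔
      ∃ y ∈ burnsideKernel (L ⧸ C), subquotientInd L C y = relIncl G H x := by
  rw [inducedKernel, AddSubgroup.mem_map]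
  constructor
  · rintro ⟨y, hy, rfl⟩
    rw [AddSubgroup.mem_addSubgroupOf] at hy
    exact ⟨y, (AddSubgroup.mem_inf.1 hy).1, (relIncl_relInd L C y).symm⟩
  · rintro ⟨y, hy, hyx⟩
    have hy' : y ∈ tildeBurnside L C := ⟨x, hyx.symm⟩
    refine ⟨⟨y, hy'⟩, AddSubgroup.mem_addSubgroupOf.2 (AddSubgroup.mem_inf.2 ⟨hy, hy'⟩), ?_⟩
    exact relIncl_injective G H ((relIncl_relInd L C ⟨y, hy'⟩).trans hyx)

theorem inducedKernel_le (L : Subgroup (G × H)) (C : Subgroup L) [C.Normal] :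
    inducedKernel L C ≤ relBurnsideKernel G H := by
  intro x hx
  obtain ⟨y, hy, hyx⟩ := (mem_inducedKernel_iff L C x).1 hx
  rw [mem_burnsideKernel_iff] at hy
  rw [mem_relBurnsideKernel_iff]
  intro g
  rw [← hyx]
  by_cases hg : g ∈ L
  · rw [fixHom_subquotientInd_of_mem L C ⟨g, hg⟩, hy, mul_zero]
  · exact fixHom_subquotientInd_of_notMem L C hg y

/-- An element of the relative Burnside kernel supported between `C` and `L` is induced from the
Burnside kernel of `L / C`. -/
theorem mem_inducedKernel_of_mem_closure (L C : Subgroup (G × H)) {x : RelBurnsideGroup G H}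
    (hx : x ∈ relBurnsideKernel G H)
    (hxc : x ∈ AddSubgroup.closure (relCosetElt '' {D | IsFreeSubgroup D ∧ C ≤ D ∧ D ≤ L})) :
    x ∈ inducedKernel L (C.subgroupOf L) := by
  have h : AddSubgroup.closure (relCosetElt '' {D | IsFreeSubgroup D ∧ C ≤ D ∧ D ≤ L}) ≤
      (subquotientInd L (C.subgroupOf L)).range.comap (relIncl G H) := by
    rw [AddSubgroup.closure_le]
    rintro _ ⟨D, ⟨hD, hC, hL⟩, rfl⟩
    -- Because C ≤ D ≤ L, the set E/D is induced from (L/C)/(D/C).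
    refine ⟨cosetElt ((D.subgroupOf L).map (QuotientGroup.mk' (C.subgroupOf L))), ?_⟩
    rw [subquotientInd_cosetElt, relIncl_relCosetElt hD, Subgroup.comap_map_eq,
      QuotientGroup.ker_mk', sup_eq_left.2 (show C.subgroupOf L ≤ D.subgroupOf L from Subgroup.comap_mono hC),
      Subgroup.map_subgroupOf_eq_of_le hL]
  obtain ⟨y, hy⟩ := h hxc
  refine (mem_inducedKernel_iff L _ x).2 ⟨y, ?_, hy⟩
  rw [mem_burnsideKernel_iff]
  intro q
  obtain ⟨g, rfl⟩ := QuotientGroup.mk_surjective q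
  have h1 := (mem_relBurnsideKernel_iff x).1 hx g
  rw [← hy, fixHom_subquotientInd_of_mem] at h1
  -- The fixed-point number of g on x is [E:L] times that of its coset on y, and the index is
  -- nonzero.
  exact (mul_eq_zero.1 h1).resolve_left (Nat.cast_ne_zero.2 Subgroup.index_ne_zero_of_finite)

end RelTransitive
end RelBurnside

namespace RelBurnside
open Algebra (GrothendieckAddGroup)

/-! ### Intermediate subgroups and the rank two relation -/

section SubgroupLattice

variable {E : Type u} [CommGroup E] [Finite E]

omit [Finite E] in
theorem card_mul_relIndex {K P : Subgroup E} (h : K ≤ P) :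
    Nat.card K * K.relIndex P = Nat.card P := by
  have := Subgroup.relIndex_mul_relIndex (⊥ : Subgroup E) K P bot_le h
  rwa [Subgroup.relIndex_bot_left, Subgroup.relIndex_bot_left] at this

theorem eq_of_relIndex_eq {K l P : Subgroup E} (h1 : K ≤ l) (h2 : l ≤ P)
    (h : K.relIndex l = K.relIndex P) : l = P := by
  have h3 := Subgroup.relIndex_mul_relIndex K l P h1 h2
  rw [h] at h3
  have h4 : K.relIndex P ≠ 0 := Subgroup.index_ne_zero_of_finite
  exact le_antisymm h2 (Subgroup.relIndex_eq_one.1 (mul_eq_left₀ h4 |>.1 h3))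

theorem eq_of_index_eq {l P : Subgroup E} (h2 : l ≤ P) (h : l.index = P.index) : l = P := by
  have h3 := Subgroup.relIndex_mul_index h2
  rw [h] at h3
  exact le_antisymm h2 (Subgroup.relIndex_eq_one.1
    (mul_eq_right₀ Subgroup.index_ne_zero_of_finite |>.1 h3))

variable {p : ℕ} [hp : Fact p.Prime]

omit [Finite E] in
theorem relIndex_sup_zpowers (hE : ∀ g : E, g ^ p = 1) {K : Subgroup E} {g : E} (hg : g ∉ K) :
    K.relIndex (K ⊔ Subgroup.zpowers g) = p := by
  have hg1 : g ≠ 1 := fun h => hg (h ▸ one_mem K)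
  have h1 : K.relIndex (Subgroup.zpowers g) ∣ p := by
    have := Subgroup.relIndex_dvd_card K (Subgroup.zpowers g)
    rwa [Nat.card_zpowers, orderOf_eq_prime (hE g) hg1] at this
  rw [sup_comm, Subgroup.relIndex_sup_right]
  refine ((Nat.dvd_prime hp.out).1 h1).resolve_left fun h => hg ?_
  exact Subgroup.relIndex_eq_one.1 h (Subgroup.mem_zpowers g)

omit [Finite E] in
theorem relIndex_of_between {K l P : Subgroup E} (h1 : K < l) (h2 : l < P)
    (h : K.relIndex P = p ^ 2) : K.relIndex l = p ∧ l.relIndex P = p := by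
  refine (hp.out.mul_eq_prime_sq_iff ?_ ?_).1 ?_
  · exact fun h => h1.not_ge (Subgroup.relIndex_eq_one.1 h)
  · exact fun h => h2.not_ge (Subgroup.relIndex_eq_one.1 h)
  · rw [Subgroup.relIndex_mul_relIndex K l P h1.le h2.le, h]

/-- The subgroups strictly between `K` and `P`. -/
noncomputable def between (K P : Subgroup E) : Finset (Subgroup E) :=
  (Set.toFinite (Set.Ioo K P)).toFinset

theorem mem_between {K l P : Subgroup E} : l ∈ between K P ↔ K < l ∧ l < P := by
  rw [between, Set.Finite.mem_toFinset, Set.mem_Ioo]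

/-- Together with `sup_zpowers_mem_between`, this says that the lines of P/K partition P ∖ K: each g
there lies in exactly one intermediate subgroup. -/
theorem sup_zpowers_eq_iff (hE : ∀ g : E, g ^ p = 1) {K l P : Subgroup E} (h : K.relIndex P = p ^ 2)
    (hl : l ∈ between K P) {g : E} (hg : g ∉ K) : K ⊔ Subgroup.zpowers g = l ↔ g ∈ l := by
  rw [mem_between] at hl
  refine ⟨?_, fun hgl => ?_⟩
  · rintro rfl
    exact Subgroup.mem_sup_right (Subgroup.mem_zpowers g)
  · refine eq_of_relIndex_eq le_sup_left (sup_le hl.1.le (Subgroup.zpowers_le.2 hgl)) ?_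
    rw [relIndex_sup_zpowers hE hg, (relIndex_of_between hl.1 hl.2 h).1]

theorem sup_zpowers_mem_between (hE : ∀ g : E, g ^ p = 1) {K P : Subgroup E} (hKP : K ≤ P)
    (h : K.relIndex P = p ^ 2) {g : E} (hgP : g ∈ P) (hg : g ∉ K) :
    K ⊔ Subgroup.zpowers g ∈ between K P := by
  have h1 := relIndex_sup_zpowers hE hg
  rw [mem_between]
  refine ⟨lt_of_le_of_ne le_sup_left fun h2 => ?_,
    lt_of_le_of_ne (sup_le hKP (Subgroup.zpowers_le.2 hgP)) fun h2 => ?_⟩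
  · rw [← h2, Subgroup.relIndex_self] at h1
    exact hp.out.one_lt.ne h1
  · rw [h2, h] at h1
    have := hp.out.one_lt
    nlinarith

/-- P ∖ K has |K|(p² − 1) elements and is partitioned by the intermediate l into pieces l ∖ K of
size |K|(p − 1). -/
theorem card_between (hE : ∀ g : E, g ^ p = 1) {K P : Subgroup E} (hKP : K ≤ P)
    (h : K.relIndex P = p ^ 2) : (between K P).card = p + 1 := by
  classical
  have := Fintype.ofFinite E
  have hcard : ∀ D : Subgroup E, K ≤ D →
      (({g | g ∈ D ∧ g ∉ K} : Finset E).card : ℤ) = Nat.card K * (K.relIndex D - 1) := by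
    intro D hD
    have h1 : ({g | g ∈ D} : Finset E).card = Nat.card D := by
      rw [Nat.card_eq_fintype_card, Fintype.card_subtype]
    have h2 : ({g | g ∈ K} : Finset E).card = Nat.card K := by
      rw [Nat.card_eq_fintype_card, Fintype.card_subtype]
    have h3 := Finset.card_filter_add_card_filter_not (s := ({g | g ∈ D} : Finset E)) (· ∈ K)
    rw [Finset.filter_filter, Finset.filter_filter, h1, ← card_mul_relIndex hD,
      Finset.filter_congr (q := (· ∈ K)) fun g _ => ⟨And.right, fun hg => ⟨hD hg, hg⟩⟩, h2] at h3
    zify at h3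
    linear_combination h3
  have h4 := Finset.card_eq_sum_card_fiberwise (f := fun g => K ⊔ Subgroup.zpowers g)
    (s := {g | g ∈ P ∧ g ∉ K}) (t := between K P) (fun g hg => by
      rw [Finset.mem_coe, Finset.mem_filter_univ] at hg
      exact sup_zpowers_mem_between hE hKP h hg.1 hg.2)
  have h5 : ∀ l ∈ between K P,
      ((({g ∈ ({g | g ∈ P ∧ g ∉ K} : Finset E) | K ⊔ Subgroup.zpowers g = l}).card : ℕ) : ℤ) =
        Nat.card K * (p - 1) := by
    intro l hl
    have hl' := mem_between.1 hl
    rw [← (relIndex_of_between hl'.1 hl'.2 h).1, ← hcard l hl'.1.le]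
    congr 2
    ext g
    simp only [Finset.mem_filter, Finset.mem_univ, true_and]
    constructor
    · rintro ⟨⟨_, h2⟩, h3⟩
      exact ⟨(sup_zpowers_eq_iff hE h hl h2).1 h3, h2⟩
    · rintro ⟨h1, h2⟩
      exact ⟨⟨hl'.2.le h1, h2⟩, (sup_zpowers_eq_iff hE h hl h2).2 h1⟩
  zify at h4
  rw [hcard P hKP, Finset.sum_congr rfl h5, h, Finset.sum_const, nsmul_eq_mul] at h4
  have h6 : (Nat.card K : ℤ) * (p - 1) ≠ 0 := by
    refine mul_ne_zero (Nat.cast_ne_zero.2 Nat.card_pos.ne') ?_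
    have := hp.out.one_lt
    omega
  push_cast at h4
  have h7 : ((between K P).card : ℤ) = p + 1 := mul_right_cancel₀ h6 (by rw [← h4]; ring)
  exact_mod_cast h7

/-- The generator of the Burnside kernel of the rank two elementary abelian group `P / K`, as a
virtual `E`-set. -/
noncomputable def rankTwoElt (p : ℕ) (K P : Subgroup E) : BurnsideGroup E :=
  cosetElt K - ∑ l ∈ between K P, cosetElt l + p • cosetElt P

/-- In units of the index of P, an element of K contributes p² − (p + 1)p + p = 0, an element of P ∖
K lies on one line and contributes −p + p = 0, and an element outside P fixes nothing. -/
theorem fixHom_rankTwoElt (hE : ∀ g : E, g ^ p = 1) {K P : Subgroup E} (hKP : K ≤ P)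
    (h : K.relIndex P = p ^ 2) (g : E) : fixHom E g (rankTwoElt p K P) = 0 := by
  classical
  have hK : (K.index : ℤ) = p ^ 2 * P.index := by
    rw [← Subgroup.relIndex_mul_index hKP, h]
    push_cast
    rfl
  have hl : ∀ l ∈ between K P, fixHom E g (cosetElt l) = if g ∈ l then (p * P.index : ℤ) else 0 := by
    intro l hl
    rw [mem_between] at hl
    rw [fixHom_cosetElt, ← Subgroup.relIndex_mul_index hl.2.le,
      (relIndex_of_between hl.1 hl.2 h).2]
    push_cast
    rfl
  rw [rankTwoElt, map_add, map_sub, map_sum, map_nsmul, Finset.sum_congr rfl hl, fixHom_cosetElt,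
    fixHom_cosetElt, hK, nsmul_eq_mul]
  by_cases hgK : g ∈ K
  · rw [if_pos hgK, if_pos (hKP hgK), Finset.sum_congr rfl fun l hl =>
      if_pos ((mem_between.1 hl).1.le hgK), Finset.sum_const, card_between hE hKP h]
    push_cast [nsmul_eq_mul]
    ring
  rw [if_neg hgK]
  by_cases hgP : g ∈ P
  · rw [if_pos hgP, Finset.sum_congr rfl fun l hl => if_congr
      (sup_zpowers_eq_iff hE h hl hgK).symm rfl rfl, Finset.sum_ite_eq,
      if_pos (sup_zpowers_mem_between hE hKP h hgP hgK)]
    ring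
  · rw [if_neg hgP, Finset.sum_congr rfl fun l hl =>
      if_neg fun hgl => hgP ((mem_between.1 hl).2.le hgl)]
    simp

end SubgroupLattice

section ElementaryAbelian

variable {p : ℕ} [hp : Fact p.Prime]

/-- Such a group is a vector space over ℤ/p, and its order determines the dimension. -/
theorem nonempty_mulEquiv_of_card {Q : Type*} [CommGroup Q] (hQ : ∀ q : Q, q ^ p = 1)
    (hc : Nat.card Q = p ^ 3) : Nonempty (Q ≃* Multiplicative (Fin 3 → ZMod p)) := by
  have : Finite Q := Nat.finite_of_card_ne_zero (hc ▸ pow_ne_zero 3 hp.out.ne_zero)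
  let _ : Module (ZMod p) (Additive Q) := AddCommGroup.zmodModule (n := p) fun q => hQ q.toMul
  have h1 : Nat.card (Additive Q) = Nat.card (ZMod p) ^ Module.finrank (ZMod p) (Additive Q) :=
    Module.natCard_eq_pow_finrank
  rw [Nat.card_zmod, Nat.card_congr Additive.toMul, hc] at h1
  have h2 := Nat.pow_right_injective hp.out.two_le h1
  have e : Additive Q ≃ₗ[ZMod p] (Fin 3 → ZMod p) :=
    LinearEquiv.ofFinrankEq _ _ (by rw [← h2, Module.finrank_fin_fun])
  exact ⟨AddEquiv.toMultiplicativeRight e.toAddEquiv⟩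

end ElementaryAbelian

end RelBurnside

namespace RelBurnside
open Algebra (GrothendieckAddGroup)

/-! ### Reduction modulo rank three subquotients -/

section Generation

variable {G : Type u} {H : Type v} [CommGroup G] [CommGroup H] [Finite G] [Finite H]
variable {p : ℕ} [hp : Fact p.Prime]

variable (G H) in
/-- The subgroup `H` of `G × H`. -/
def rightFactor : Subgroup (G × H) := (MonoidHom.inr G H).range

omit [Finite G] [Finite H] in
theorem isFreeSubgroup_iff_disjoint {D : Subgroup (G × H)} :
    IsFreeSubgroup D ↔ Disjoint D (rightFactor G H) := by
  rw [Subgroup.disjoint_def]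
  constructor
  · rintro hD _ hx ⟨h, rfl⟩
    rw [hD h hx, map_one]
  · intro hD h hh
    exact congrArg Prod.snd (hD hh ⟨h, rfl⟩)

omit [Finite G] [Finite H] hp in
theorem relIndex_sup_rightFactor (hH : Nat.card H = p) {D : Subgroup (G × H)}
    (hD : IsFreeSubgroup D) : D.relIndex (D ⊔ rightFactor G H) = p := by
  rw [sup_comm, Subgroup.relIndex_sup_right, ← Subgroup.inf_relIndex_right,
    disjoint_iff.1 (isFreeSubgroup_iff_disjoint.1 hD), Subgroup.relIndex_bot_left, ← hH]
  exact (Nat.card_congr (MonoidHom.ofInjective (f := MonoidHom.inr G H)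
    fun a b h => congrArg Prod.snd h).toEquiv).symm

omit [Finite G] [Finite H] in
-- H has prime order, so a subgroup meets it trivially or contains it.
theorem rightFactor_le_of_not_isFreeSubgroup (hH : Nat.card H = p) {D : Subgroup (G × H)}
    (hD : ¬ IsFreeSubgroup D) : rightFactor G H ≤ D := by
  rw [← Subgroup.relIndex_eq_one]
  have hc : Nat.card (rightFactor G H) = p := by
    rw [← hH]
    exact (Nat.card_congr (MonoidHom.ofInjective (f := MonoidHom.inr G H)
      fun a b h => congrArg Prod.snd h).toEquiv).symm
  have h1 := Subgroup.relIndex_dvd_card D (rightFactor G H)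
  rw [hc] at h1
  refine ((Nat.dvd_prime hp.out).1 h1).resolve_right fun h2 => hD ?_
  have h3 := card_mul_relIndex (inf_le_right : D ⊓ rightFactor G H ≤ _)
  rw [Subgroup.inf_relIndex_right, h2, hc] at h3
  rw [isFreeSubgroup_iff_disjoint, disjoint_iff]
  exact Subgroup.eq_bot_of_card_eq _ (Nat.eq_of_mul_eq_mul_right hp.out.pos (by rw [h3, one_mul]))

/-- Otherwise D⟨g⟩ would contain DH; both have index p over D, so they would coincide and g would
lie in DH. -/
theorem isFreeSubgroup_sup_zpowers (hE : ∀ g : G × H, g ^ p = 1) (hH : Nat.card H = p)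
    {D : Subgroup (G × H)} (hD : IsFreeSubgroup D) {g : G × H} (hg : g ∉ D ⊔ rightFactor G H) :
    IsFreeSubgroup (D ⊔ Subgroup.zpowers g) := by
  by_contra h
  have h1 := rightFactor_le_of_not_isFreeSubgroup hH h
  have hgD : g ∉ D := fun h2 => hg (Subgroup.mem_sup_left h2)
  have h2 : D ⊔ rightFactor G H = D ⊔ Subgroup.zpowers g :=
    eq_of_relIndex_eq le_sup_left (sup_le le_sup_left h1)
      ((relIndex_sup_rightFactor hH hD).trans (relIndex_sup_zpowers hE hgD).symm)
  exact hg (h2 ▸ Subgroup.mem_sup_right (Subgroup.mem_zpowers g))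

variable (G H) in
/-- The sum of the subgroups of `A(G, H)` induced from the kernels of the subquotients of `G × H`
that are elementary abelian of rank three. -/
noncomputable def rankThreeInduced (p : ℕ) : AddSubgroup (RelBurnsideGroup G H) :=
  ⨆ (L : Subgroup (G × H)) (C : Subgroup L) (_ : C.Normal)
    (_ : Nonempty ((L ⧸ C) ≃* Multiplicative (Fin 3 → ZMod p))), inducedKernel L C

theorem rankThreeInduced_le (p : ℕ) : rankThreeInduced G H p ≤ relBurnsideKernel G H :=
  iSup_le fun L => iSup_le fun C => iSup_le fun _ => iSup_le fun _ => inducedKernel_le L C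

theorem mem_rankThreeInduced (hE : ∀ g : G × H, g ^ p = 1) {L C : Subgroup (G × H)}
    (hCL : C.relIndex L = p ^ 3) {x : RelBurnsideGroup G H}
    (hx : ∀ g, fixHom (G × H) g (relIncl G H x) = 0)
    (hxc : x ∈ AddSubgroup.closure (relCosetElt '' {D | IsFreeSubgroup D ∧ C ≤ D ∧ D ≤ L})) :
    x ∈ rankThreeInduced G H p := by
  have h1 := mem_inducedKernel_of_mem_closure L C ((mem_relBurnsideKernel_iff x).2 hx) hxc
  have h2 : Nonempty ((L ⧸ C.subgroupOf L) ≃* Multiplicative (Fin 3 → ZMod p)) := by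
    refine nonempty_mulEquiv_of_card (fun q => ?_) hCL
    obtain ⟨g, rfl⟩ := QuotientGroup.mk_surjective q
    rw [← QuotientGroup.mk_pow, show g ^ p = 1 from Subtype.ext (hE g), QuotientGroup.mk_one]
  exact AddSubgroup.mem_iSup_of_mem L (AddSubgroup.mem_iSup_of_mem (C.subgroupOf L)
    (AddSubgroup.mem_iSup_of_mem (inferInstanceAs (C.subgroupOf L).Normal)
      (AddSubgroup.mem_iSup_of_mem h2 h1)))

/-- The rank two relation for a pair of free subgroups `K ≤ P`. -/
theorem rankTwo_mem (hE : ∀ g : G × H, g ^ p = 1) (hH : Nat.card H = p) {K P : Subgroup (G × H)}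
    (hKP : K ≤ P) (hP : IsFreeSubgroup P) (h : K.relIndex P = p ^ 2) :
    relCosetElt K - ∑ l ∈ between K P, relCosetElt l + p • relCosetElt P ∈
      rankThreeInduced G H p := by
  have hfree : ∀ {l}, l ≤ P → IsFreeSubgroup l := fun hl h hh => hP h (hl hh)
  -- P/K has rank two only; adjoining H, which meets P trivially, raises the rank to three.
  refine mem_rankThreeInduced hE (C := K) (L := P ⊔ rightFactor G H) ?_ (fun g => ?_) ?_
  · rw [← Subgroup.relIndex_mul_relIndex K P _ hKP le_sup_left, h, relIndex_sup_rightFactor hH hP]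
    ring
  · rw [← fixHom_rankTwoElt hE hKP h g, rankTwoElt, map_add, map_sub, map_sum, map_nsmul,
      relIncl_relCosetElt (hfree hKP), relIncl_relCosetElt hP]
    rw [Finset.sum_congr rfl fun l hl => relIncl_relCosetElt (hfree (mem_between.1 hl).2.le)]
  · have hmem : ∀ l, K ≤ l → l ≤ P → relCosetElt l ∈ AddSubgroup.closure
        (relCosetElt '' {D | IsFreeSubgroup D ∧ K ≤ D ∧ D ≤ P ⊔ rightFactor G H}) :=
      fun l h1 h2 => AddSubgroup.subset_closure ⟨l, ⟨hfree h2, h1, h2.trans le_sup_left⟩, rfl⟩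
    exact add_mem (sub_mem (hmem K le_rfl hKP) (sum_mem fun l hl =>
      hmem l (mem_between.1 hl).1.le (mem_between.1 hl).2.le)) (nsmul_mem (hmem P hKP le_rfl) p)

/-- The free subgroups of index `i`. -/
def freeOfIndex (G : Type u) (H : Type v) [CommGroup G] [CommGroup H] (i : ℕ) :
    Set (Subgroup (G × H)) := {D | IsFreeSubgroup D ∧ D.index = i}

/-- Modulo `rankThreeInduced`, two free subgroups `K`, `K'` of index `p ^ 2` with `K H = K' H`
differ by complements of `H`. -/
theorem relCosetElt_sub_mem (hE : ∀ g : G × H, g ^ p = 1) (hH : Nat.card H = p)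
    {K K' : Subgroup (G × H)} (hK : K ∈ freeOfIndex G H (p ^ 2))
    (hK' : K' ∈ freeOfIndex G H (p ^ 2)) (h : K ⊔ rightFactor G H = K' ⊔ rightFactor G H) :
    relCosetElt K - relCosetElt K' ∈
      rankThreeInduced G H p ⊔ AddSubgroup.closure (relCosetElt '' freeOfIndex G H p) := by
  classical
  obtain rfl | hne := eq_or_ne K K'
  · rw [sub_self]
    exact zero_mem _
  set M := K ⊔ rightFactor G H with hM
  have hMK := relIndex_sup_rightFactor hH hK.1
  have hMK' := relIndex_sup_rightFactor hH hK'.1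
  rw [← hM] at hMK
  rw [← h] at hMK'
  have hKM : K ≤ M := le_sup_left
  have hKM' : K' ≤ M := h ▸ le_sup_left
  have hMi : M.index = p := by
    have := Subgroup.relIndex_mul_index hKM
    rw [hMK, hK.2, sq] at this
    exact Nat.eq_of_mul_eq_mul_left hp.out.pos this
  have hsup : K ⊔ K' = M := by
    refine eq_of_relIndex_eq (K := K) le_sup_left (sup_le hKM hKM') ?_
    have h1 : K.relIndex (K ⊔ K') ∣ p := by
      rw [← hMK, ← Subgroup.relIndex_mul_relIndex K (K ⊔ K') M le_sup_left (sup_le hKM hKM')]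
      exact dvd_mul_right _ _
    rw [hMK]
    refine ((Nat.dvd_prime hp.out).1 h1).resolve_left fun h2 => hne ?_
    have h3 : K' ≤ K := le_sup_right.trans (Subgroup.relIndex_eq_one.1 h2)
    exact (eq_of_index_eq h3 (hK'.2.trans hK.2.symm)).symm
  -- As KK' = M has index p over K', so has K ∩ K' over K. Thus E/(K ∩ K') has rank three.
  have hinf : (K ⊓ K').index = p ^ 3 := by
    rw [← Subgroup.relIndex_mul_index (inf_le_left : K ⊓ K' ≤ K), Subgroup.inf_relIndex_left, hK.2,
      ← Subgroup.relIndex_sup_right, hsup, hMK']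
    ring
  have hrel : ∀ {D : Subgroup (G × H)}, D ∈ freeOfIndex G H (p ^ 2) →
      D.relIndex ⊤ = p ^ 2 := fun hD => by rw [Subgroup.relIndex_top_right, hD.2]
  -- A non-free subgroup strictly between D and E contains DH = M and has the same index over D, so
  -- it is M.
  have hnonfree : ∀ {D : Subgroup (G × H)}, D ∈ freeOfIndex G H (p ^ 2) →
      D ⊔ rightFactor G H = M →
      (between D ⊤).filter (fun l => ¬ IsFreeSubgroup l) = {M} := by
    intro D hD hDM
    have hDM1 := relIndex_sup_rightFactor hH hD.1
    rw [hDM] at hDM1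
    have hDM2 : D ≤ M := hDM ▸ le_sup_left
    ext l
    rw [Finset.mem_filter, Finset.mem_singleton, mem_between]
    constructor
    · rintro ⟨⟨h1, h2⟩, h3⟩
      refine (eq_of_relIndex_eq hDM2 ?_ ?_).symm
      · rw [← hDM]
        exact sup_le h1.le (rightFactor_le_of_not_isFreeSubgroup hH h3)
      · rw [hDM1, (relIndex_of_between h1 h2 (hrel hD)).1]
    · rintro rfl
      refine ⟨⟨lt_of_le_of_ne hDM2 fun h1 => ?_, lt_top_iff_ne_top.2 fun h1 => ?_⟩, fun h1 => ?_⟩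
      · rw [← h1, Subgroup.relIndex_self] at hDM1
        exact hp.out.one_lt.ne hDM1
      · rw [h1, Subgroup.index_top] at hMi
        exact hp.out.one_lt.ne hMi
      · have h2 := relIndex_sup_rightFactor hH h1
        rw [← hDM, sup_assoc, sup_idem, Subgroup.relIndex_self] at h2
        exact hp.out.one_lt.ne h2
  let y : Subgroup (G × H) → RelBurnsideGroup G H := fun D =>
    ∑ l ∈ (between D ⊤).filter IsFreeSubgroup, relCosetElt l
  -- The correction to the rank two relation involves only M and E, not D, so it cancels in the
  -- difference for K and K'.
  have hfix : ∀ {D : Subgroup (G × H)}, D ∈ freeOfIndex G H (p ^ 2) →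
      D ⊔ rightFactor G H = M → relIncl G H (relCosetElt D - y D) =
        rankTwoElt p D ⊤ + cosetElt M - p • cosetElt ⊤ := by
    intro D hD hDM
    have h1 : relIncl G H (y D) = ∑ l ∈ (between D ⊤).filter IsFreeSubgroup, cosetElt l := by
      rw [map_sum]
      exact Finset.sum_congr rfl fun l hl => relIncl_relCosetElt (Finset.mem_filter.1 hl).2
    rw [map_sub, h1, relIncl_relCosetElt hD.1, rankTwoElt,
      ← Finset.sum_filter_add_sum_filter_not (between D ⊤) IsFreeSubgroup, hnonfree hD hDM,
      Finset.sum_singleton]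
    abel
  have hy : ∀ {D : Subgroup (G × H)}, D ∈ freeOfIndex G H (p ^ 2) → y D ∈
      AddSubgroup.closure (relCosetElt '' freeOfIndex G H p) := fun hD =>
    sum_mem fun l hl => by
      rw [Finset.mem_filter, mem_between] at hl
      have h1 := (relIndex_of_between hl.1.1 hl.1.2 (hrel hD)).2
      rw [Subgroup.relIndex_top_right] at h1
      exact AddSubgroup.subset_closure ⟨l, ⟨hl.2, h1⟩, rfl⟩
  have hmem : (relCosetElt K - y K) - (relCosetElt K' - y K') ∈ rankThreeInduced G H p := by
    refine mem_rankThreeInduced hE (C := K ⊓ K') (L := ⊤) ?_ (fun g => ?_) ?_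
    · rw [Subgroup.relIndex_top_right, hinf]
    · rw [map_sub, hfix hK hM.symm, hfix hK' h.symm, map_sub, map_sub, map_sub, map_add, map_add,
        fixHom_rankTwoElt hE le_top (hrel hK), fixHom_rankTwoElt hE le_top (hrel hK'), sub_self]
    · have h1 : ∀ {D : Subgroup (G × H)}, D ∈ freeOfIndex G H (p ^ 2) → K ⊓ K' ≤ D →
          relCosetElt D - y D ∈ AddSubgroup.closure
            (relCosetElt '' {D | IsFreeSubgroup D ∧ K ⊓ K' ≤ D ∧ D ≤ ⊤}) := fun hD hle =>
        sub_mem (AddSubgroup.subset_closure ⟨_, ⟨hD.1, hle, le_top⟩, rfl⟩) (sum_mem fun l hl => by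
          rw [Finset.mem_filter, mem_between] at hl
          exact AddSubgroup.subset_closure ⟨l, ⟨hl.2, hle.trans hl.1.1.le, le_top⟩, rfl⟩)
      exact sub_mem (h1 hK inf_le_left) (h1 hK' inf_le_right)
  have h2 : relCosetElt K - relCosetElt K' =
      ((relCosetElt K - y K) - (relCosetElt K' - y K')) + (y K - y K') := by abel
  rw [h2]
  exact add_mem (AddSubgroup.mem_sup_left hmem) (AddSubgroup.mem_sup_right (sub_mem (hy hK) (hy hK')))

/-- Modulo `rankThreeInduced`, the group `A(G, H)` is generated by the free subgroups of index
`p` and `p ^ 2`. -/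
theorem relCosetElt_mem_sup (hE : ∀ g : G × H, g ^ p = 1) (hH : Nat.card H = p)
    {K : Subgroup (G × H)} (hK : IsFreeSubgroup K) :
    relCosetElt K ∈ rankThreeInduced G H p ⊔
      (AddSubgroup.closure (relCosetElt '' freeOfIndex G H p) ⊔
        AddSubgroup.closure (relCosetElt '' freeOfIndex G H (p ^ 2))) := by
  induction hn : K.index using Nat.strong_induction_on generalizing K with
  | _ n ih =>
  subst hn
  by_cases h1 : K ⊔ rightFactor G H = ⊤
  · have h2 := relIndex_sup_rightFactor hH hK
    rw [h1, Subgroup.relIndex_top_right] at h2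
    exact AddSubgroup.mem_sup_right (AddSubgroup.mem_sup_left
      (AddSubgroup.subset_closure ⟨K, ⟨hK, h2⟩, rfl⟩))
  obtain ⟨g, hg⟩ : ∃ g, g ∉ K ⊔ rightFactor G H := by
    by_contra! h
    exact h1 ((Subgroup.eq_top_iff' _).2 h)
  have hgK : g ∉ K := fun h => hg (Subgroup.mem_sup_left h)
  set l := K ⊔ Subgroup.zpowers g with hl
  have hlfree : IsFreeSubgroup l := isFreeSubgroup_sup_zpowers hE hH hK hg
  have hKl : K.relIndex l = p := relIndex_sup_zpowers hE hgK
  by_cases h2 : l ⊔ rightFactor G H = ⊤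
  · have h3 := relIndex_sup_rightFactor hH hlfree
    rw [h2, Subgroup.relIndex_top_right] at h3
    have h4 := Subgroup.relIndex_mul_index (le_sup_left : K ≤ l)
    rw [h3, hKl, ← sq] at h4
    exact AddSubgroup.mem_sup_right (AddSubgroup.mem_sup_right
      (AddSubgroup.subset_closure ⟨K, ⟨hK, h4.symm⟩, rfl⟩))
  obtain ⟨g', hg'⟩ : ∃ g, g ∉ l ⊔ rightFactor G H := by
    by_contra! h
    exact h2 ((Subgroup.eq_top_iff' _).2 h)
  have hgl : g' ∉ l := fun h => hg' (Subgroup.mem_sup_left h)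
  -- Two successive free enlargements give a free P of rank two over K; its relation expresses K by
  -- free subgroups of smaller index.
  set P := l ⊔ Subgroup.zpowers g' with hP
  have hPfree : IsFreeSubgroup P := isFreeSubgroup_sup_zpowers hE hH hlfree hg'
  have hKP : K ≤ P := le_sup_left.trans le_sup_left
  have hKP2 : K.relIndex P = p ^ 2 := by
    rw [← Subgroup.relIndex_mul_relIndex K l P le_sup_left le_sup_left, hKl,
      relIndex_sup_zpowers hE hgl, sq]
  have hindex : ∀ D : Subgroup (G × H), K < D → D.index < K.index := fun D hD => by
    refine lt_of_le_of_ne (Nat.le_of_dvd (Nat.pos_of_ne_zero Subgroup.index_ne_zero_of_finite)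
      (Subgroup.index_dvd_of_le hD.le)) fun h => hD.ne (eq_of_index_eq hD.le h.symm)
  have hKltP : K < P := lt_of_le_of_ne hKP fun h => by
    rw [← h, Subgroup.relIndex_self] at hKP2
    exact (one_lt_pow₀ hp.out.one_lt two_ne_zero).ne hKP2
  have h3 := rankTwo_mem hE hH hKP hPfree hKP2
  have h4 : relCosetElt K = (relCosetElt K - ∑ l ∈ between K P, relCosetElt l +
      p • relCosetElt P) + ((∑ l ∈ between K P, relCosetElt l) - p • relCosetElt P) := by abel
  rw [h4]
  refine add_mem (AddSubgroup.mem_sup_left h3) (sub_mem (sum_mem fun D hD => ?_) (nsmul_mem ?_ p))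
  · rw [mem_between] at hD
    exact ih _ (hindex D hD.1) (fun h hh => hPfree h (hD.2.le hh)) rfl
  · exact ih _ (hindex P hKltP) hPfree rfl

/-! ### Independence of the remaining generators -/

/-- A combination of the elements counting fixed points that detects the subgroups contained in
the subgroup `M` of index `p`. -/
noncomputable def hyperplaneHom (p : ℕ) (M : Subgroup (G × H)) : RelBurnsideGroup G H →+ ℤ := by
  classical
  exact letI := Fintype.ofFinite (G × H)
    ∑ g : G × H, ((if g ∈ M then (p : ℤ) else 0) - 1) • (fixHom (G × H) g).comp (relIncl G H)

omit hp in
theorem hyperplaneHom_eq_zero {x : RelBurnsideGroup G H} (hx : x ∈ relBurnsideKernel G H)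
    (M : Subgroup (G × H)) : hyperplaneHom p M x = 0 := by
  rw [hyperplaneHom, AddMonoidHom.finsetSum_apply]
  refine Finset.sum_eq_zero fun g _ => ?_
  rw [AddMonoidHom.smul_apply, AddMonoidHom.comp_apply, (mem_relBurnsideKernel_iff x).1 hx g,
    smul_zero]

open Classical in
-- The weights, p − 1 on M and −1 off M, sum over D to p|M ∩ D| − |D|. This is (p − 1)|D| if D ≤ M;
-- otherwise M ∩ D has index p in D and the sum vanishes.
theorem hyperplaneHom_relCosetElt {M : Subgroup (G × H)} (hM : M.index = p)
    {D : Subgroup (G × H)} (hD : IsFreeSubgroup D) :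
    hyperplaneHom p M (relCosetElt D) =
      if D ≤ M then (p - 1) * (Nat.card (G × H) : ℤ) else 0 := by
  have := Fintype.ofFinite (G × H)
  have hcard : ∀ A : Subgroup (G × H), (({g | g ∈ A} : Finset (G × H)).card) = Nat.card A := by
    intro A
    rw [Nat.card_eq_fintype_card, Fintype.card_subtype]
  have h1 : hyperplaneHom p M (relCosetElt D) =
      (p * Nat.card (M ⊓ D : Subgroup (G × H)) - Nat.card D) * D.index := by
    rw [hyperplaneHom, AddMonoidHom.finsetSum_apply, ← hcard, ← hcard, Finset.card_filter,
      Finset.card_filter]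
    push_cast
    rw [Finset.mul_sum, ← Finset.sum_sub_distrib, Finset.sum_mul]
    refine Finset.sum_congr (by congr; exact Subsingleton.elim _ _) fun g _ => ?_
    rw [Pi.smul_apply, AddMonoidHom.comp_apply, relIncl_relCosetElt hD, fixHom_cosetElt,
      smul_eq_mul]
    by_cases h2 : g ∈ M <;> by_cases h3 : g ∈ D <;> simp [h2, h3]
  rw [h1]
  have h2 := card_mul_relIndex (inf_le_right : M ⊓ D ≤ D)
  rw [Subgroup.inf_relIndex_right] at h2
  split_ifs with h
  · rw [inf_eq_right.2 h, ← D.card_mul_index]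
    push_cast
    ring
  · have h3 : M.relIndex D = p := by
      have := M.relIndex_dvd_index_of_normal D
      rw [hM] at this
      exact ((Nat.dvd_prime hp.out).1 this).resolve_left fun h4 => h (Subgroup.relIndex_eq_one.1 h4)
    rw [h3] at h2
    rw [← h2]
    push_cast
    ring

/-- A family with a system of functionals dual to it (up to a nonzero scalar) is independent. -/
theorem eq_zero_of_mem_closure_of_dual {A ι : Type*} [AddCommGroup A] (T : Set ι) (f : ι → A)
    (φ : ι → A →+ ℤ) {c : ℤ} (hc : c ≠ 0) (h1 : ∀ i ∈ T, φ i (f i) = c)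
    (h2 : ∀ i ∈ T, ∀ j ∈ T, i ≠ j → φ i (f j) = 0) {x : A} (hx : x ∈ AddSubgroup.closure (f '' T))
    (h : ∀ i ∈ T, φ i x = 0) : x = 0 := by
  classical
  rw [← Submodule.span_int_eq_addSubgroupClosure, Submodule.mem_toAddSubgroup,
    Finsupp.mem_span_image_iff_linearCombination] at hx
  obtain ⟨a, ha, rfl⟩ := hx
  rw [Finsupp.mem_supported] at ha
  suffices a = 0 by rw [this, map_zero]
  ext i
  by_contra hi
  have hiT : i ∈ T := ha (Finsupp.mem_support_iff.2 hi)
  have h3 := h i hiT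
  rw [Finsupp.linearCombination_apply, Finsupp.sum, map_sum, Finset.sum_eq_single i] at h3
  · rw [map_zsmul, h1 i hiT, smul_eq_mul] at h3
    exact (mul_ne_zero hi hc) h3
  · intro j hj hji
    rw [map_zsmul, h2 i hiT j (ha hj) hji.symm, smul_zero]
  · intro h4
    exact absurd (Finsupp.mem_support_iff.2 hi) h4

theorem relBurnsideKernel_eq_rankThreeInduced (hE : ∀ g : G × H, g ^ p = 1)
    (hH : Nat.card H = p) : relBurnsideKernel G H = rankThreeInduced G H p := by
  classical
  refine le_antisymm (fun x hx => ?_) (rankThreeInduced_le p)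
  let H' := rightFactor G H
  -- One chosen free subgroup of index p² for each product M = KH; the default ⊥ is never used,
  -- since `rep` is only evaluated at such products. R is the set of choices.
  let rep : Subgroup (G × H) → Subgroup (G × H) := fun M =>
    if h : ∃ K ∈ freeOfIndex G H (p ^ 2), K ⊔ H' = M then h.choose else ⊥
  have hrep : ∀ K ∈ freeOfIndex G H (p ^ 2),
      rep (K ⊔ H') ∈ freeOfIndex G H (p ^ 2) ∧ rep (K ⊔ H') ⊔ H' = K ⊔ H' := by
    intro K hK
    have h : ∃ K' ∈ freeOfIndex G H (p ^ 2), K' ⊔ H' = K ⊔ H' := ⟨K, hK, rfl⟩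
    simp only [rep, dif_pos h]
    exact h.choose_spec
  let R : Set (Subgroup (G × H)) := (fun K => rep (K ⊔ H')) '' freeOfIndex G H (p ^ 2)
  have hR : ∀ t ∈ R, t ∈ freeOfIndex G H (p ^ 2) ∧ rep (t ⊔ H') = t := by
    rintro _ ⟨K, hK, rfl⟩
    exact ⟨(hrep K hK).1, congrArg rep (hrep K hK).2⟩
  have hRi : ∀ t ∈ R, (t ⊔ H').index = p := by
    intro t ht
    have h1 := Subgroup.relIndex_mul_index (le_sup_left : t ≤ t ⊔ H')
    rw [relIndex_sup_rightFactor hH (hR t ht).1.1, (hR t ht).1.2, sq] at h1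
    exact Nat.eq_of_mul_eq_mul_left hp.out.pos h1
  have hle : AddSubgroup.closure (relCosetElt '' freeOfIndex G H (p ^ 2)) ≤
      (rankThreeInduced G H p ⊔ AddSubgroup.closure (relCosetElt '' freeOfIndex G H p)) ⊔
        AddSubgroup.closure (relCosetElt '' R) := by
    rw [AddSubgroup.closure_le]
    rintro _ ⟨K, hK, rfl⟩
    rw [SetLike.mem_coe, ← sub_add_cancel (relCosetElt K) (relCosetElt (rep (K ⊔ H')))]
    exact add_mem
      (AddSubgroup.mem_sup_left (relCosetElt_sub_mem hE hH hK (hrep K hK).1 (hrep K hK).2.symm))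
      (AddSubgroup.mem_sup_right (AddSubgroup.subset_closure ⟨_, ⟨K, hK, rfl⟩, rfl⟩))
  have hx1 : x ∈ (rankThreeInduced G H p ⊔
      AddSubgroup.closure (relCosetElt '' freeOfIndex G H p)) ⊔
        AddSubgroup.closure (relCosetElt '' R) := by
    refine (AddSubgroup.closure_le _).2 ?_ (mem_closure_relCosetElt x)
    rintro _ ⟨K, hK, rfl⟩
    have h1 := relCosetElt_mem_sup hE hH hK
    rw [← sup_assoc] at h1
    exact (sup_le le_sup_left hle) h1
  obtain ⟨w, hw, z, hz, rfl⟩ := AddSubgroup.mem_sup.1 hx1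
  obtain ⟨s, hs, y, hy, rfl⟩ := AddSubgroup.mem_sup.1 hw
  have hyz : y + z ∈ relBurnsideKernel G H := by
    have h1 := sub_mem hx (rankThreeInduced_le p hs)
    rwa [add_assoc, add_sub_cancel_left] at h1
  have hc : (p - 1) * (Nat.card (G × H) : ℤ) ≠ 0 := by
    refine mul_ne_zero ?_ (Nat.cast_ne_zero.2 Nat.card_pos.ne')
    have := hp.out.one_lt
    omega
  -- Test with M = tH for t in R. A free D of index p inside M would equal M and contain H, so y is
  -- invisible; another t' in R inside M would have t'H = tH, hence t' = t.
  have hz0 : z = 0 := by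
    refine eq_zero_of_mem_closure_of_dual R relCosetElt (fun t => hyperplaneHom p (t ⊔ H')) hc
      (fun t ht => ?_) (fun t ht t' ht' hne => ?_) hz (fun t ht => ?_)
    · rw [hyperplaneHom_relCosetElt (hRi t ht) (hR t ht).1.1, if_pos le_sup_left]
    · rw [hyperplaneHom_relCosetElt (hRi t ht) (hR t' ht').1.1, if_neg]
      intro h1
      have h2 : t' ⊔ H' = t ⊔ H' := eq_of_index_eq (sup_le h1 le_sup_right)
        ((hRi t' ht').trans (hRi t ht).symm)
      exact hne ((hR t ht).2.symm.trans ((congrArg rep h2.symm).trans (hR t' ht').2))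
    · have h1 : AddSubgroup.closure (relCosetElt '' freeOfIndex G H p) ≤
          (hyperplaneHom p (t ⊔ H')).ker := by
        rw [AddSubgroup.closure_le]
        rintro _ ⟨D, hD, rfl⟩
        change hyperplaneHom p (t ⊔ H') (relCosetElt D) = 0
        rw [hyperplaneHom_relCosetElt (hRi t ht) hD.1, if_neg]
        intro h2
        have h3 := eq_of_index_eq h2 (hD.2.trans (hRi t ht).symm)
        have h4 := relIndex_sup_rightFactor hH hD.1
        rw [h3, sup_assoc, sup_idem, Subgroup.relIndex_self] at h4
        exact hp.out.one_lt.ne h4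
      have h2 := hyperplaneHom_eq_zero (p := p) hyz (t ⊔ H')
      rwa [map_add, show hyperplaneHom p (t ⊔ H') y = 0 from h1 hy, zero_add] at h2
  subst hz0
  -- With z gone, the free subgroups of index p serve as test subgroups themselves: containment
  -- between two of them forces equality.
  have hy0 : y = 0 := by
    rw [add_zero] at hyz
    refine eq_zero_of_mem_closure_of_dual (freeOfIndex G H p) relCosetElt (hyperplaneHom p) hc
      (fun t ht => ?_) (fun t ht t' ht' hne => ?_) hy (fun t _ => hyperplaneHom_eq_zero hyz t)
    · rw [hyperplaneHom_relCosetElt ht.2 ht.1, if_pos le_rfl]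
    · rw [hyperplaneHom_relCosetElt ht.2 ht'.1, if_neg]
      exact fun h1 => hne (eq_of_index_eq h1 (ht'.2.trans ht.2.symm)).symm
  subst hy0
  rwa [add_zero, add_zero]

end Generation

/-! ### The two families of subquotients -/

section Main

/-- If Q is commutative, so is T, which rules out the two nonabelian types; what remains is ℤ_p² × H
≅ ℤ_p³. -/
theorem nonempty_mulEquiv_iff_exists_tornehave {H : Type v} [CommGroup H] {p : ℕ}
    [hp : Fact p.Prime] (hH : ∀ h : H, h ^ p = 1) (hc : Nat.card H = p) {Q : Type*} [Group Q]
    (hQ : ∀ a b : Q, a * b = b * a) :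
    Nonempty (Q ≃* Multiplicative (Fin 3 → ZMod p)) ↔
      ∃ (T : Type) (_ : Group T), IsTornehaveGroup p T ∧ Nonempty (Q ≃* T × H) := by
  have key : Nonempty (Multiplicative (ZMod p × ZMod p) × H ≃*
      Multiplicative (Fin 3 → ZMod p)) := by
    refine nonempty_mulEquiv_of_card (fun q => Prod.ext ?_ (hH q.2)) ?_
    · change p • (Multiplicative.toAdd q.1) = 0
      ext <;> simp
    · rw [Nat.card_prod, Nat.card_congr Multiplicative.toAdd, Nat.card_prod, Nat.card_zmod, hc]
      ring
  obtain ⟨k⟩ := key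
  constructor
  · rintro ⟨e⟩
    exact ⟨_, inferInstance, Or.inl ⟨MulEquiv.refl _⟩, ⟨e.trans k.symm⟩⟩
  · rintro ⟨T, _, hT, ⟨e⟩⟩
    have hcomm : ∀ a b : T, a * b = b * a := fun a b => by
      have h := hQ (e.symm (a, 1)) (e.symm (b, 1))
      rw [← map_mul, ← map_mul] at h
      exact congrArg Prod.fst (e.symm.injective h)
    obtain ⟨⟨f⟩⟩ | ⟨n, hn, ⟨f⟩⟩ | ⟨-, -, a, b, hab⟩ := hT
    · exact ⟨e.trans ((f.prodCongr (MulEquiv.refl H)).trans k)⟩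
    · exfalso
      -- Commuting the rotation `r 1` with the reflection `sr 0` gives −1 = 1 in ℤ/n, so n divides
      -- 2, against n ≥ 3.
      have h := congrArg f (hcomm (f.symm (DihedralGroup.r 1)) (f.symm (DihedralGroup.sr 0)))
      rw [map_mul, map_mul, f.apply_symm_apply, f.apply_symm_apply, DihedralGroup.r_mul_sr,
        DihedralGroup.sr_mul_r, DihedralGroup.sr.injEq] at h
      have h2 : ((2 : ℕ) : ZMod n) = 0 := by
        push_cast
        linear_combination -h
      rw [ZMod.natCast_eq_zero_iff] at h2
      have := Nat.le_of_dvd two_pos h2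
      omega
    · exact absurd (hcomm a b) hab

end Main
end RelBurnside
theorem mainTheorem3 {G : Type u} {H : Type v} [CommGroup G] [Finite G] [Group H] [Finite H]
    (p : ℕ) [Fact p.Prime] (hG : ∀ g : G, g ^ p = 1)
    (hH : Nonempty (H ≃* Multiplicative (ZMod p))) :
    RelBurnside.relBurnsideKernel G H =
      (⨆ (L : Subgroup (G × H)) (C : Subgroup L) (_ : C.Normal)
        (_ : Nonempty ((L ⧸ C) ≃* Multiplicative (Fin 3 → ZMod p))),
        RelBurnside.inducedKernel L C) ∧
    RelBurnside.relBurnsideKernel G H =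
      (⨆ (L : Subgroup (G × H)) (C : Subgroup L) (_ : C.Normal)
        (_ : ∃ (T : Type) (_ : Group T), RelBurnside.IsTornehaveGroup p T ∧
          Nonempty ((L ⧸ C) ≃* T × H)),
        RelBurnside.inducedKernel L C) := by
  obtain ⟨e⟩ := hH
  -- The structure extends the given group structure on H, so the groups in the statement are
  -- unchanged.
  let _ : CommGroup H := { ‹Group H› with
    mul_comm := fun a b => e.injective (by rw [map_mul, map_mul, mul_comm]) }
  have hpow : ∀ h : H, h ^ p = 1 := fun h => e.injective (by
    rw [map_pow, map_one]
    change p • (Multiplicative.toAdd (e h)) = 0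
    simp)
  have hcard : Nat.card H = p := by
    rw [Nat.card_congr e.toEquiv, Nat.card_congr Multiplicative.toAdd, Nat.card_zmod]
  have h1 := RelBurnside.relBurnsideKernel_eq_rankThreeInduced (G := G) (H := H) (p := p)
    (fun g => Prod.ext (hG g.1) (hpow g.2)) hcard
  refine ⟨h1, h1.trans ?_⟩
  refine iSup_congr fun L => iSup_congr fun C => iSup_congr fun _ => ?_
  refine iSup_congr_Prop (RelBurnside.nonempty_mulEquiv_iff_exists_tornehave hpow hcard ?_)
    fun _ => rfl
  intro a b
  induction a using QuotientGroup.induction_on with | _ a =>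
  induction b using QuotientGroup.induction_on with | _ b =>
  exact congrArg _ (mul_comm a b)
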